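/- Let $(\Omega,\mathcal A,\mathbb P)$ be a probability space with a filtration $(\mathcal F_t)_{t\ge 0}$, let $T\ge 0$, let $K,g_0\in L^1([0,T])$ be nonnegative, and let $b\le 0\le c$. Let $(U_{0,t})_{t\le T}$ be an adapted, almost surely continuous and non-decreasing process, and let $(Z_{0,t})_{t\le T}$ be an almost surely continuous $(\mathcal F_t)$-martingale with quadratic variation $\langle Z_{0,\cdot}\rangle=U_{0,\cdot}$ (that is, $Z_{0,\cdot}^2-U_{0,\cdot}$ is a local martingale), both starting from $0$, such that for every $t\le T$, almost surely, $$U_{0,t}=\int_0^t g_0(r)\,dr+\int_0^t K(t-r)\,\bigl(bU_{0,r}+cZ_{0,r}\bigr)\,dr .$$ For $0\le s\le t\le T$ write $U_{s,t}=U_{0,t}-U_{0,s}$ and $Z_{s,t}=Z_{0,t}-Z_{0,s}$, and set $$G_s(t)=\int_s^t g_0(u)\,du+\int_0^s\Bigl(\int_s^t K(u-r)\,du\Bigr)\bigl(b\,dU_{0,r}+c\,dZ_{0,r}\bigr),$$ where the $dU$-integral is a pathwise Lebesgue–Stieltjes integral and the $dZ$-integral is an Itô integral. Then, for all $0\le s\le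 t\le T$, both integrals are well defined (the $dU$-integral almost surely, the Itô integral up to null sets), $G_s(t)$ is $\mathcal F_s$-measurable (it agrees almost surely with an $\mathcal F_s$-measurable random variable, and is itself $\mathcal F_s$-measurable if $\mathcal F_s$ contains all $\mathbb P$-null sets), and almost surely the function $r\mapsto K(t-r)(bU_{s,r}+cZ_{s,r})$ is integrable on $[s,t]$ and $$U_{s,t}=G_s(t)+\int_s^t K(t-r)\,\bigl(bU_{s,r}+cZ_{s,r}\bigr)\,dr .$$ -/

import Mathlib

open MeasureTheory ProbabilityTheory Filter Topology
open scoped NNReal ENNReal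

noncomputable section

namespace Volterra

variable {Ω : Type*} {mΩ : MeasurableSpace Ω}

/-- The increment `X_{s,t} = X_t - X_s` of a process. -/
def incr (X : ℝ≥0 → Ω → ℝ) (s t : ℝ≥0) (ω : Ω) : ℝ := X t ω - X s ω

open Classical in
/-- The Lebesgue–Stieltjes measure `dA` on `(0, s]` of a path `A` which is non-decreasing on
`[0, s]` (the path is frozen outside `[0, s]`); by convention `0` for other paths. -/
def stieltjesMeasure (A : ℝ≥0 → ℝ) (s : ℝ≥0) : Measure ℝ :=
  if h : Monotone (fun r : ℝ => A (min r.toNNReal s)) then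
    h.stieltjesFunction.measure.restrict (Set.Ioc 0 (s : ℝ))
  else 0

/-- A bounded simple predictable process `∑_{i < n} ξ_i 1_{(t_i, t_{i+1}]}`, where
`t_0 ≤ t_1 ≤ …` and each `ξ_i` is bounded and `𝓕_{t_i}`-measurable. -/
structure SimplePredictable (𝓕 : Filtration ℝ≥0 mΩ) where
  n : ℕ
  time : ℕ → ℝ≥0
  time_mono : Monotone time
  coeff : ℕ → Ω → ℝ
  coeff_meas : ∀ i, StronglyMeasurable[𝓕 (time i)] (coeff i)
  coeff_bdd : ∃ C : ℝ, ∀ i ω, |coeff i ω| ≤ C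

/-- The value at time `r` of a simple predictable process. -/
def SimplePredictable.eval {𝓕 : Filtration ℝ≥0 mΩ} (S : SimplePredictable 𝓕)
    (r : ℝ) (ω : Ω) : ℝ :=
  ∑ i ∈ Finset.range S.n,
    (Set.Ioc (S.time i : ℝ) (S.time (i + 1) : ℝ)).indicator (fun _ => S.coeff i ω) r

/-- The elementary stochastic integral `∑ ξ_i (Z_{t_{i+1} ∧ s} - Z_{t_i ∧ s})`. -/
def SimplePredictable.integral {𝓕 : Filtration ℝ≥0 mΩ} (S : SimplePredictable 𝓕)
    (Z : ℝ≥0 → Ω → ℝ) (s : ℝ≥0) (ω : Ω) : ℝ :=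
  ∑ i ∈ Finset.range S.n,
    S.coeff i ω * (Z (min (S.time (i + 1)) s) ω - Z (min (S.time i) s) ω)

/-- `I` is (a version of) the Itô integral `∫_0^s H_r dZ_r`, where `A` is the quadratic variation
of the continuous square-integrable martingale `Z`: there are bounded simple predictable processes
`S_n` with `E ∫_0^s |S_n - H|² dA → 0` and `∫_0^s S_n dZ → I` in `L²(P)`. -/
def IsItoIntegral (𝓕 : Filtration ℝ≥0 mΩ) (P : Measure Ω) (Z A : ℝ≥0 → Ω → ℝ)
    (H : ℝ → Ω → ℝ) (s : ℝ≥0) (I : Ω → ℝ) : Prop :=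
  MemLp I 2 P ∧ ∃ S : ℕ → SimplePredictable 𝓕,
    Tendsto (fun n => ∫⁻ ω, ∫⁻ r, ‖(S n).eval r ω - H r ω‖ₑ ^ 2
      ∂(stieltjesMeasure (fun u => A u ω) s) ∂P) atTop (𝓝 0) ∧
    Tendsto (fun n => eLpNorm (fun ω => (S n).integral Z s ω - I ω) 2 P) atTop (𝓝 0)

open Classical in
/-- The Itô integral `∫_0^s H_r dZ_r` (a chosen version; `0` if there is none). -/
def itoIntegral (𝓕 : Filtration ℝ≥0 mΩ) (P : Measure Ω) (Z A : ℝ≥0 → Ω → ℝ)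
    (H : ℝ → Ω → ℝ) (s : ℝ≥0) : Ω → ℝ :=
  if h : ∃ I, IsItoIntegral 𝓕 P Z A H s I then h.choose else 0

/-- `(U, Z)` solves, on the time interval `[0, T]`,
`U_t = ∫_0^t g₀(r) dr + ∫_0^t K(t - r) (b U_r + c Z_r) dr`,
where `U` is a continuous non-decreasing adapted process and `Z` is a continuous martingale with
quadratic variation `U`, both starting from `0`. A process indexed by `[0, T]` is viewed as one on
`[0, ∞)` by freezing it at `T`, which is what `min t T` does below. -/
structure IsSolution (K g₀ : ℝ → ℝ) (b c : ℝ) (T : ℝ≥0) (𝓕 : Filtration ℝ≥0 mΩ)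
    (P : Measure Ω) (U Z : ℝ≥0 → Ω → ℝ) : Prop where
  U_adapted : ∀ t ≤ T, StronglyMeasurable[𝓕 t] (U t)
  U_zero : ∀ᵐ ω ∂P, U 0 ω = 0
  U_mono : ∀ᵐ ω ∂P, MonotoneOn (fun t => U t ω) (Set.Iic T)
  U_cont : ∀ᵐ ω ∂P, ContinuousOn (fun t => U t ω) (Set.Iic T)
  Z_martingale : Martingale (fun t => Z (min t T)) 𝓕 P
  Z_zero : ∀ᵐ ω ∂P, Z 0 ω = 0
  Z_cont : ∀ᵐ ω ∂P, ContinuousOn (fun t => Z t ω) (Set.Iic T)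
  /-- `⟨Z⟩ = U`: the process `Z² - U` is a local martingale. -/
  quadVar : Locally (fun X => Martingale X 𝓕 P) 𝓕
    (fun t ω => Z (min t T) ω ^ 2 - U (min t T) ω) P
  equation : ∀ t ≤ T, ∀ᵐ ω ∂P,
    U t ω = (∫ r in (0 : ℝ)..t, g₀ r) +
      ∫ r in (0 : ℝ)..t, K (t - r) * (b * U r.toNNReal ω + c * Z r.toNNReal ω)

/-- The (deterministic) integrand `r ↦ ∫_s^t K(u - r) du`. -/
def kernelInt (K : ℝ → ℝ) (s t : ℝ≥0) (r : ℝ) : ℝ := ∫ u in (s : ℝ)..t, K (u - r)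

/-- `G_s(t) = ∫_s^t g₀(u) du + ∫_0^s ∫_s^t K(u - r) du (b dU_r + c dZ_r)`. -/
def G (K g₀ : ℝ → ℝ) (b c : ℝ) (𝓕 : Filtration ℝ≥0 mΩ) (P : Measure Ω)
    (U Z : ℝ≥0 → Ω → ℝ) (s t : ℝ≥0) (ω : Ω) : ℝ :=
  (∫ u in (s : ℝ)..t, g₀ u) +
    (b * ∫ r, kernelInt K s t r ∂(stieltjesMeasure (fun u => U u ω) s) +
      c * itoIntegral 𝓕 P Z U (fun r _ => kernelInt K s t r) s ω)

end Volterra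

end

/-!
Since `r ↦ ∫_s^t K(u - r) du` is deterministic and absolutely continuous, integration by parts gives
its integral against any continuous path a pathwise meaning: it is the limit of the left-endpoint
Riemann–Stieltjes sums along uniform partitions. Splitting the convolution `∫_0^t K(t - r) x_r dr`
at `s` and subtracting the equation at time `s` from the one at time `t` therefore yields the
dynamics of the increments path by path, with this pathwise integral in the place of the stochastic
one.

It remains to see that the Itô integral exists and equals the pathwise integral. Subtracting the
part of the convolution over a short interval `[t - δ, t]` bounds `U_t` by an integrable variable
plus a multiple of `U_{t - δ}`, so `U_t` is integrable whatever the sign of `b`. The local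
martingale `Z² - U` is then bounded below by `-U_t` on `[0, t]`, hence it is a supermartingale, and
this alone makes the elementary stochastic integral a contraction from `L²(dU ⊗ P)` to `L²(P)`.
Consequently any simple approximation of the integrand yields the same `L²` limit, and for the step
functions on uniform partitions that limit is the almost sure one.
-/

namespace Volterra

section LocalSupermartingale

variable {ι Ω : Type*} {mΩ : MeasurableSpace Ω} {P : Measure Ω}

lemma lintegral_ofReal_sub_le_iff {f₁ f₂ g : Ω → ℝ} (hf₁ : Integrable f₁ P)
    (hf₂ : Integrable f₂ P) (hg : Integrable g P) (h₁ : ∀ᵐ ω ∂P, g ω ≤ f₁ ω)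
    (h₂ : ∀ᵐ ω ∂P, g ω ≤ f₂ ω) :
    ∫⁻ ω, ENNReal.ofReal (f₁ ω - g ω) ∂P ≤ ∫⁻ ω, ENNReal.ofReal (f₂ ω - g ω) ∂P ↔
      ∫ ω, f₁ ω ∂P ≤ ∫ ω, f₂ ω ∂P := by
  have hnonneg : 0 ≤ᵐ[P] fun ω => f₂ ω - g ω := h₂.mono fun ω => sub_nonneg.2
  rw [← ofReal_integral_eq_lintegral_ofReal (hf₁.sub' hg) (h₁.mono fun ω => sub_nonneg.2),
    ← ofReal_integral_eq_lintegral_ofReal (hf₂.sub' hg) hnonneg,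
    ENNReal.ofReal_le_ofReal_iff (integral_nonneg_of_ae hnonneg), integral_sub hf₁ hg,
    integral_sub hf₂ hg, sub_le_sub_iff_right]

lemma setLIntegral_ofReal_sub_le_of_supermartingale [Preorder ι] [IsFiniteMeasure P]
    {𝓕 : Filtration ι mΩ} {Y : ι → Ω → ℝ} (hY : Supermartingale Y 𝓕 P)
    {a b : ι} (hab : a ≤ b) {g : Ω → ℝ} (hg : Integrable g P) {A : Set Ω}
    (hA : MeasurableSet[𝓕 a] A) (hga : ∀ᵐ ω ∂P.restrict A, g ω ≤ Y a ω)
    (hgb : ∀ᵐ ω ∂P.restrict A, g ω ≤ Y b ω) :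
    ∫⁻ ω in A, ENNReal.ofReal (Y b ω - g ω) ∂P ≤ ∫⁻ ω in A, ENNReal.ofReal (Y a ω - g ω) ∂P :=
  (lintegral_ofReal_sub_le_iff (hY.integrable b).restrict (hY.integrable a).restrict hg.restrict
    hgb hga).2 (hY.setIntegral_le hab hA)

variable [LinearOrder ι] [OrderBot ι]

lemma stoppedProcess_indicator_eq_of_lt {X : ι → Ω → ℝ} {τ : Ω → WithTop ι} {t : ι} {ω : Ω}
    (h : (t : WithTop ι) < τ ω) :
    stoppedProcess (fun i => {ω | ⊥ < τ ω}.indicator (X i)) τ t ω = X t ω := by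
  have hbot : ⊥ < τ ω := bot_le.trans_lt h
  simp [stoppedProcess, min_eq_left h.le, Set.indicator, hbot]

lemma exists_le_stoppedProcess_indicator_eq {X : ι → Ω → ℝ} {τ : Ω → WithTop ι} {ω : Ω}
    (h : ⊥ < τ ω) (t : ι) :
    ∃ r ≤ t, stoppedProcess (fun i => {ω | ⊥ < τ ω}.indicator (X i)) τ t ω = X r ω := by
  rcases lt_or_ge (t : WithTop ι) (τ ω) with ht | ht
  · exact ⟨t, le_rfl, stoppedProcess_indicator_eq_of_lt ht⟩
  · obtain ⟨r, hr⟩ := WithTop.ne_top_iff_exists.1 (ht.trans_lt (WithTop.coe_lt_top t)).ne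
    refine ⟨r, WithTop.coe_le_coe.1 (hr ▸ ht), ?_⟩
    rw [stoppedProcess, min_eq_right ht, Set.indicator_of_mem (show ω ∈ {ω | ⊥ < τ ω} from h),
      ← hr]
    rfl

variable [IsFiniteMeasure P] {𝓕 : Filtration ι mΩ} {X : ι → Ω → ℝ}

lemma setLIntegral_ofReal_stoppedProcess_sub_le {τ : Ω → WithTop ι} (hτ : IsStoppingTime 𝓕 τ)
    (hY : Supermartingale (stoppedProcess (fun i => {ω | ⊥ < τ ω}.indicator (X i)) τ) 𝓕 P)
    {a b : ι} (hab : a ≤ b) {g : Ω → ℝ} (hg : Integrable g P)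
    (hgX : ∀ᵐ ω ∂P, ∀ r ≤ b, g ω ≤ X r ω) {A : Set Ω} (hA : MeasurableSet[𝓕 a] A) :
    ∫⁻ ω in A ∩ {ω | (a : WithTop ι) < τ ω}, ENNReal.ofReal
      (stoppedProcess (fun i => {ω | ⊥ < τ ω}.indicator (X i)) τ b ω - g ω) ∂P ≤
      ∫⁻ ω in A, ENNReal.ofReal (X a ω - g ω) ∂P := by
  have hlt : MeasurableSet[𝓕 a] {ω | (a : WithTop ι) < τ ω} := by
    simpa only [Set.compl_ofPred, not_le] using (hτ a).compl
  have hAlt := hA.inter hlt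
  have hge (t : ι) (ht : t ≤ b) : ∀ᵐ ω ∂P.restrict (A ∩ {ω | (a : WithTop ι) < τ ω}),
      g ω ≤ stoppedProcess (fun i => {ω | ⊥ < τ ω}.indicator (X i)) τ t ω := by
    filter_upwards [ae_restrict_of_ae hgX, ae_restrict_mem (𝓕.le a _ hAlt)] with ω hω hmem
    obtain ⟨r, hr, h⟩ := exists_le_stoppedProcess_indicator_eq (X := X)
      (bot_le.trans_lt hmem.2) t
    exact (hω r (hr.trans ht)).trans h.ge
  have hle := setLIntegral_ofReal_sub_le_of_supermartingale hY hab hg hAlt (hge a hab)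
    (hge b le_rfl)
  have heq := setLIntegral_congr_fun (μ := P) (𝓕.le a _ hAlt) fun ω hω =>
    congrArg (fun x => ENNReal.ofReal (x - g ω))
      (stoppedProcess_indicator_eq_of_lt (X := X) hω.2)
  exact (hle.trans_eq heq).trans (lintegral_mono_set Set.inter_subset_left)

variable [TopologicalSpace ι] [OrderTopology ι]

lemma setLIntegral_ofReal_sub_le_of_locally_supermartingale
    (hX : Locally (fun Y => Supermartingale Y 𝓕 P) 𝓕 X P)
    {a b : ι} (hab : a ≤ b) {g : Ω → ℝ}
    (hg : Integrable g P) (hgX : ∀ᵐ ω ∂P, ∀ r ≤ b, g ω ≤ X r ω) {A : Set Ω}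
    (hA : MeasurableSet[𝓕 a] A) :
    ∫⁻ ω in A, ENNReal.ofReal (X b ω - g ω) ∂P ≤ ∫⁻ ω in A, ENNReal.ofReal (X a ω - g ω) ∂P := by
  set τ := hX.localSeq
  have hτ : IsLocalizingSequence 𝓕 τ P := hX.isLocalizingSequence_localSeq
  set Y : ℕ → Ω → ℝ := fun n => stoppedProcess (fun i => {ω | ⊥ < τ n ω}.indicator (X i)) (τ n) b
  set f : ℕ → Ω → ℝ≥0∞ := fun n =>
    {ω | (a : WithTop ι) < τ n ω}.indicator fun ω => ENNReal.ofReal (Y n ω - g ω)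
  have hlt (n : ℕ) : MeasurableSet {ω | (a : WithTop ι) < τ n ω} := by
    simpa only [Set.compl_ofPred, not_le] using 𝓕.le a _ (hτ.isStoppingTime n a).compl
  have hf (n : ℕ) : AEMeasurable (f n) (P.restrict A) :=
    ((((hX.stoppedProcess_localSeq n).integrable b).sub hg).aemeasurable.ennreal_ofReal.indicator
      (hlt n)).restrict
  have hf_eventually : ∀ᵐ ω ∂P.restrict A,
      ENNReal.ofReal (X b ω - g ω) = liminf (fun n => f n ω) atTop := by
    filter_upwards [ae_restrict_of_ae hτ.tendsto_top] with ω hω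
    refine (Tendsto.liminf_eq (tendsto_const_nhds.congr' ?_)).symm
    filter_upwards [hω.eventually_const_lt (WithTop.coe_lt_top b)] with n hn
    have han : (a : WithTop ι) < τ n ω := (WithTop.coe_le_coe.2 hab).trans_lt hn
    simp only [f, Y, Set.indicator, Set.mem_ofPred_eq, if_pos han]
    rw [← stoppedProcess_indicator_eq_of_lt (X := X) hn]
  rw [lintegral_congr_ae hf_eventually]
  refine (lintegral_liminf_le' hf).trans (liminf_le_of_le (by isBoundedDefault) fun c hc => ?_)
  obtain ⟨n, hn⟩ := hc.exists
  refine hn.trans ?_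
  rw [setLIntegral_indicator (hlt n), Set.inter_comm]
  exact setLIntegral_ofReal_stoppedProcess_sub_le (hτ.isStoppingTime n)
    (hX.stoppedProcess_localSeq n) hab hg hgX hA

theorem supermartingale_of_locally
    (hX : Locally (fun Y => Supermartingale Y 𝓕 P) 𝓕 X P) (hXm : StronglyAdapted 𝓕 X)
    (hX0 : Integrable (X ⊥) P) {g : ι → Ω → ℝ} (hg : ∀ t, Integrable (g t) P)
    (hgX : ∀ t, ∀ᵐ ω ∂P, ∀ r ≤ t, g t ω ≤ X r ω) : Supermartingale X 𝓕 P := by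
  have hle {a b t : ι} (hab : a ≤ b) (hbt : b ≤ t) {A : Set Ω} (hA : MeasurableSet[𝓕 a] A) :=
    setLIntegral_ofReal_sub_le_of_locally_supermartingale hX hab (hg t)
      ((hgX t).mono fun ω h r hr => h r (hr.trans hbt)) hA
  have hnonneg {a t : ι} (hat : a ≤ t) : 0 ≤ᵐ[P] fun ω => X a ω - g t ω :=
    (hgX t).mono fun ω h => sub_nonneg.2 (h a hat)
  have hint (t : ι) : Integrable (X t) P := by
    have hsub : Integrable (fun ω => X t ω - g t ω) P := by
      refine ⟨((hXm t).mono (𝓕.le t)).aestronglyMeasurable.sub (hg t).aestronglyMeasurable, ?_⟩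
      rw [hasFiniteIntegral_iff_ofReal (hnonneg le_rfl)]
      have h := hle (bot_le (a := t)) le_rfl .univ
      simp only [Measure.restrict_univ] at h
      exact h.trans_lt ((hasFiniteIntegral_iff_ofReal (hnonneg bot_le)).1
        (hX0.sub (hg t)).hasFiniteIntegral)
    simpa only [sub_add_cancel] using hsub.fun_add (hg t)
  rw [← neg_neg X]
  refine (submartingale_of_setIntegral_le hXm.neg (fun t => (hint t).neg)
    fun a b hab A hA => ?_).neg
  simp only [Pi.neg_apply, integral_neg, neg_le_neg_iff]
  exact (lintegral_ofReal_sub_le_iff (hint b).restrict (hint a).restrict (hg b).restrict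
    (ae_restrict_of_ae ((hgX b).mono fun ω h => h b le_rfl))
    (ae_restrict_of_ae ((hgX b).mono fun ω h => h a hab))).1 (hle hab le_rfl hA)

end LocalSupermartingale

section Stieltjes

variable {A B : ℝ≥0 → ℝ} {s : ℝ≥0}

lemma stieltjesMeasure_congr (h : Set.EqOn A B (Set.Iic s)) :
    stieltjesMeasure A s = stieltjesMeasure B s := by
  have hfun : (fun r : ℝ => A (min r.toNNReal s)) = fun r : ℝ => B (min r.toNNReal s) :=
    funext fun r => h (Set.mem_Iic.2 (min_le_right _ _))
  classical
  exact congrArg (fun f : ℝ → ℝ =>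
    if h : Monotone f then h.stieltjesFunction.measure.restrict (Set.Ioc 0 (s : ℝ)) else 0) hfun

lemma ae_stieltjesMeasure_mem_Ioc (A : ℝ≥0 → ℝ) (s : ℝ≥0) :
    ∀ᵐ r ∂(stieltjesMeasure A s), r ∈ Set.Ioc (0 : ℝ) s := by
  unfold stieltjesMeasure
  split_ifs
  · exact ae_restrict_mem measurableSet_Ioc
  · simp

lemma stieltjesMeasure_Ioc (hA : MonotoneOn A (Set.Iic s)) (hA_cont : ContinuousOn A (Set.Iic s))
    {u v : ℝ≥0} (huv : u ≤ v) (hvs : v ≤ s) :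
    stieltjesMeasure A s (Set.Ioc (u : ℝ) v) = ENNReal.ofReal (A v - A u) := by
  have hmono : Monotone (fun r : ℝ => A (min r.toNNReal s)) := fun x y hxy =>
    hA (Set.mem_Iic.2 (min_le_right _ _)) (Set.mem_Iic.2 (min_le_right _ _))
      (min_le_min_right _ (Real.toNNReal_le_toNNReal hxy))
  have hcont : Continuous (fun r : ℝ => A (min r.toNNReal s)) :=
    hA_cont.comp_continuous (by fun_prop) fun _ => Set.mem_Iic.2 (min_le_right _ _)
  have hsub : Set.Ioc (u : ℝ) v ⊆ Set.Ioc 0 (s : ℝ) :=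
    Set.Ioc_subset_Ioc u.coe_nonneg (NNReal.coe_le_coe.2 hvs)
  unfold stieltjesMeasure
  rw [dif_pos hmono, Measure.restrict_apply measurableSet_Ioc, Set.inter_eq_left.2 hsub,
    StieltjesFunction.measure_Ioc, hmono.stieltjesFunction_eq, hmono.stieltjesFunction_eq,
    hcont.continuousWithinAt.rightLim_eq, hcont.continuousWithinAt.rightLim_eq]
  simp only [Real.toNNReal_coe, min_eq_left hvs, min_eq_left (huv.trans hvs)]

lemma stieltjesMeasure_univ (hA : MonotoneOn A (Set.Iic s))
    (hA_cont : ContinuousOn A (Set.Iic s)) :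
    stieltjesMeasure A s Set.univ = ENNReal.ofReal (A s - A 0) := by
  rw [← stieltjesMeasure_Ioc hA hA_cont zero_le le_rfl]
  refine measure_congr ?_
  filter_upwards [ae_stieltjesMeasure_mem_Ioc A s] with r hr
  exact propext ⟨fun _ => hr, fun _ => trivial⟩

lemma isFiniteMeasure_stieltjesMeasure (hA : MonotoneOn A (Set.Iic s))
    (hA_cont : ContinuousOn A (Set.Iic s)) : IsFiniteMeasure (stieltjesMeasure A s) :=
  ⟨by rw [stieltjesMeasure_univ hA hA_cont]; exact ENNReal.ofReal_lt_top⟩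

end Stieltjes

lemma enorm_sq_eq_ofReal (x : ℝ) : ‖x‖ₑ ^ 2 = ENNReal.ofReal (x ^ 2) :=
  (enorm_pow x 2).symm.trans (Real.enorm_of_nonneg (sq_nonneg x))

section QuadVarMajorant

variable {ι Ω : Type*} {mΩ : MeasurableSpace Ω} [Preorder ι]

/-- `V` dominates the quadratic variation of the square-integrable martingale `M`, in the sense
that `M² - V` is a supermartingale. This half of `⟨M⟩ = V` is all that the Itô integral needs: it
makes the elementary integral a contraction into `L²` (instead of an isometry). -/
structure IsQuadVarMajorant (𝓕 : Filtration ι mΩ) (P : Measure Ω) (M V : ι → Ω → ℝ) : Prop where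
  martingale : Martingale M 𝓕 P
  memLp (t : ι) : MemLp (M t) 2 P
  supermartingale : Supermartingale (fun t ω => M t ω ^ 2 - V t ω) 𝓕 P

variable {P : Measure Ω} {𝓕 : Filtration ι mΩ} {u v : ι} {η : Ω → ℝ}

lemma IsQuadVarMajorant.integrable {M V : ι → Ω → ℝ} (h : IsQuadVarMajorant 𝓕 P M V) (t : ι) :
    Integrable (V t) P := by
  simpa only [sub_sub_cancel] using (h.memLp t).integrable_sq.sub' (h.supermartingale.integrable t)

lemma integrable_sq_mul (hη : MemLp η ∞ P) {Y : Ω → ℝ} (hY : Integrable Y P) :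
    Integrable (fun ω => η ω ^ 2 * Y ω) P := by
  have hη_sq : MemLp (η ^ 2) ∞ P := by simpa only [sq] using hη.mul hη
  exact hη_sq.integrable_mul (memLp_one_iff_integrable.2 hY)

variable [IsFiniteMeasure P]

lemma integral_mul_eq_integral_mul_condExp {m : MeasurableSpace Ω} (hm : m ≤ mΩ)
    (hη : StronglyMeasurable[m] η) {f : Ω → ℝ} (hf : Integrable f P)
    (hηf : Integrable (fun ω => η ω * f ω) P) :
    ∫ ω, η ω * f ω ∂P = ∫ ω, η ω * (P[f|m]) ω ∂P := by
  rw [← integral_condExp hm]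
  exact integral_congr_ae (condExp_mul_of_stronglyMeasurable_left hη hηf hf)

lemma integral_mul_supermartingale_sub_nonpos {N : ι → Ω → ℝ} (hN : Supermartingale N 𝓕 P)
    (huv : u ≤ v) (hη : StronglyMeasurable[𝓕 u] η) (hη_nonneg : 0 ≤ η)
    (hint : Integrable (fun ω => η ω * (N v ω - N u ω)) P) :
    ∫ ω, η ω * (N v ω - N u ω) ∂P ≤ 0 := by
  rw [integral_mul_eq_integral_mul_condExp (𝓕.le u) hη
    ((hN.integrable v).sub' (hN.integrable u)) hint]
  refine integral_nonpos_of_ae ?_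
  filter_upwards [condExp_sub (hN.integrable v) (hN.integrable u) (𝓕 u),
    hN.condExp_ae_le huv] with ω h_sub h_le
  refine mul_nonpos_of_nonneg_of_nonpos (hη_nonneg ω) (h_sub.trans_le ?_)
  rw [Pi.sub_apply, condExp_of_stronglyMeasurable (𝓕.le u) (hN.stronglyMeasurable u)
    (hN.integrable u)]
  exact sub_nonpos.2 h_le

lemma integral_mul_martingale_sub_eq_zero {M : ι → Ω → ℝ} (hM : Martingale M 𝓕 P)
    (huv : u ≤ v) (hη : StronglyMeasurable[𝓕 u] η)
    (hint : Integrable (fun ω => η ω * (M v ω - M u ω)) P) :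
    ∫ ω, η ω * (M v ω - M u ω) ∂P = 0 := by
  rw [integral_mul_eq_integral_mul_condExp (𝓕.le u) hη
    ((hM.integrable v).sub' (hM.integrable u)) hint]
  refine integral_eq_zero_of_ae ?_
  filter_upwards [condExp_sub (hM.integrable v) (hM.integrable u) (𝓕 u),
    hM.condExp_ae_eq huv] with ω h_sub h_eq
  refine mul_eq_zero_of_right _ (h_sub.trans ?_)
  rw [Pi.sub_apply, h_eq, condExp_of_stronglyMeasurable (𝓕.le u) (hM.stronglyMeasurable u)
    (hM.integrable u), sub_self]

namespace IsQuadVarMajorant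

variable {M V : ι → Ω → ℝ} {X : Ω → ℝ}

/-- Write `(X + η ΔM)² = X² + 2 (X η - η² M_u) ΔM + η² Δ(M² - V) + η² ΔV`. -/
lemma integral_sq_add_mul_sub_le (h : IsQuadVarMajorant 𝓕 P M V) (huv : u ≤ v)
    (hX : StronglyMeasurable[𝓕 u] X) (hX_L2 : MemLp X 2 P) (hη : StronglyMeasurable[𝓕 u] η)
    (hη_top : MemLp η ∞ P) :
    ∫ ω, (X ω + η ω * (M v ω - M u ω)) ^ 2 ∂P ≤
      ∫ ω, (X ω ^ 2 + η ω ^ 2 * (V v ω - V u ω)) ∂P := by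
  set N : ι → Ω → ℝ := fun t ω => M t ω ^ 2 - V t ω
  set ζ : Ω → ℝ := fun ω => 2 * (X ω * η ω - η ω ^ 2 * M u ω)
  have hη_sq_top : MemLp (η ^ 2) ∞ P := by simpa only [sq] using hη_top.mul hη_top
  have hζ : StronglyMeasurable[𝓕 u] ζ :=
    ((hX.mul hη).sub ((hη.pow 2).mul (h.martingale.stronglyMeasurable u))).const_mul 2
  have hζ_L2 : MemLp ζ 2 P :=
    ((hη_top.mul hX_L2).sub ((h.memLp u).mul hη_sq_top)).const_mul 2
  have hζM : Integrable (fun ω => ζ ω * (M v ω - M u ω)) P :=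
    hζ_L2.integrable_mul ((h.memLp v).sub (h.memLp u))
  have hηN : Integrable (fun ω => η ω ^ 2 * (N v ω - N u ω)) P :=
    integrable_sq_mul hη_top ((h.supermartingale.integrable v).sub (h.supermartingale.integrable u))
  have hηV : Integrable (fun ω => η ω ^ 2 * (V v ω - V u ω)) P :=
    integrable_sq_mul hη_top ((h.integrable v).sub (h.integrable u))
  calc ∫ ω, (X ω + η ω * (M v ω - M u ω)) ^ 2 ∂P
      = ∫ ω, (ζ ω * (M v ω - M u ω) + η ω ^ 2 * (N v ω - N u ω) +
          (X ω ^ 2 + η ω ^ 2 * (V v ω - V u ω))) ∂P := by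
        congr! 2 with ω; simp only [ζ, N]; ring
    _ = ∫ ω, ζ ω * (M v ω - M u ω) ∂P + ∫ ω, η ω ^ 2 * (N v ω - N u ω) ∂P +
          ∫ ω, (X ω ^ 2 + η ω ^ 2 * (V v ω - V u ω)) ∂P := by
        rw [integral_add (hζM.fun_add hηN) (hX_L2.integrable_sq.fun_add hηV),
          integral_add hζM hηN]
    _ ≤ ∫ ω, (X ω ^ 2 + η ω ^ 2 * (V v ω - V u ω)) ∂P := by
        rw [integral_mul_martingale_sub_eq_zero h.martingale huv hζ hζM, zero_add]
        exact add_le_of_nonpos_left (integral_mul_supermartingale_sub_nonpos h.supermartingale huv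
          (hη.pow 2) (fun ω => sq_nonneg _) hηN)

lemma lintegral_enorm_sq_add_mul_sub_le (h : IsQuadVarMajorant 𝓕 P M V) (huv : u ≤ v)
    (hV : ∀ᵐ ω ∂P, V u ω ≤ V v ω) (hX : StronglyMeasurable[𝓕 u] X) (hX_L2 : MemLp X 2 P)
    (hη : StronglyMeasurable[𝓕 u] η) (hη_top : MemLp η ∞ P) :
    ∫⁻ ω, ‖X ω + η ω * (M v ω - M u ω)‖ₑ ^ 2 ∂P ≤
      ∫⁻ ω, ‖X ω‖ₑ ^ 2 ∂P + ∫⁻ ω, ‖η ω‖ₑ ^ 2 * ENNReal.ofReal (V v ω - V u ω) ∂P := by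
  have hsq : Integrable (fun ω => (X ω + η ω * (M v ω - M u ω)) ^ 2) P :=
    (hX_L2.add (((h.memLp v).sub (h.memLp u)).mul hη_top)).integrable_sq
  have hηV : Integrable (fun ω => η ω ^ 2 * (V v ω - V u ω)) P :=
    integrable_sq_mul hη_top ((h.integrable v).sub (h.integrable u))
  have hηV_nonneg : 0 ≤ᵐ[P] fun ω => X ω ^ 2 + η ω ^ 2 * (V v ω - V u ω) :=
    hV.mono fun ω hω => add_nonneg (sq_nonneg _) (mul_nonneg (sq_nonneg _) (sub_nonneg.2 hω))
  simp_rw [enorm_sq_eq_ofReal]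
  rw [← lintegral_add_left' (hX_L2.integrable_sq.aemeasurable.ennreal_ofReal),
    ← ofReal_integral_eq_lintegral_ofReal hsq (ae_of_all _ fun ω => sq_nonneg _)]
  refine (ENNReal.ofReal_le_ofReal
    (h.integral_sq_add_mul_sub_le huv hX hX_L2 hη hη_top)).trans ?_
  rw [ofReal_integral_eq_lintegral_ofReal (hX_L2.integrable_sq.fun_add hηV) hηV_nonneg]
  refine lintegral_mono fun ω => ENNReal.ofReal_add_le.trans ?_
  rw [ENNReal.ofReal_mul (sq_nonneg _)]

end IsQuadVarMajorant

end QuadVarMajorant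

lemma rel_of_forall_notMem_Ioo {α : Type*} [LinearOrder α] {R : α → α → Prop}
    (R_trans : ∀ ⦃u v w⦄, u ≤ v → v ≤ w → R u v → R v w → R u w) (F : Finset α)
    (hR : ∀ ⦃u v⦄, u ≤ v → (∀ x ∈ F, x ∉ Set.Ioo u v) → R u v) {u v : α} (huv : u ≤ v) :
    R u v := by
  induction F using Finset.induction generalizing u v with
  | empty => exact hR huv (by simp)
  | insert x F _ ih =>
    refine ih (fun u v huv hF => ?_) huv
    by_cases hx : x ∈ Set.Ioo u v
    · refine R_trans hx.1.le hx.2.le (hR hx.1.le ?_) (hR hx.2.le ?_)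
      · exact Finset.forall_mem_insert _ _ _ |>.2 ⟨fun h => lt_irrefl _ h.2,
          fun y hy h => hF y hy ⟨h.1, h.2.trans hx.2⟩⟩
      · exact Finset.forall_mem_insert _ _ _ |>.2 ⟨fun h => lt_irrefl _ h.1,
          fun y hy h => hF y hy ⟨hx.1.trans h.1, h.2⟩⟩
    · exact hR huv (Finset.forall_mem_insert _ _ _ |>.2 ⟨hx, hF⟩)

section ElementaryIntegral

variable {Ω : Type*} {mΩ : MeasurableSpace Ω} {P : Measure Ω}
  {𝓕 : Filtration ℝ≥0 mΩ} {M V : ℝ≥0 → Ω → ℝ} {u v s : ℝ≥0}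

namespace SimplePredictable

variable (S : SimplePredictable 𝓕)

lemma exists_abs_eval_le : ∃ C, ∀ r ω, |S.eval r ω| ≤ C := by
  obtain ⟨C, hC⟩ := S.coeff_bdd
  refine ⟨∑ _ ∈ Finset.range S.n, C, fun r ω => ?_⟩
  refine (Finset.abs_sum_le_sum_abs _ _).trans (Finset.sum_le_sum fun i _ => ?_)
  rw [Set.indicator_apply]
  split_ifs
  · exact hC i ω
  · rw [abs_zero]
    exact (abs_nonneg _).trans (hC i ω)

lemma integral_zero_time (ω : Ω) : S.integral M 0 ω = 0 := by
  simp [integral]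

lemma stronglyMeasurable_integral (hM : StronglyAdapted 𝓕 M) (t : ℝ≥0) :
    StronglyMeasurable[𝓕 t] (S.integral M t) := by
  refine Finset.stronglyMeasurable_fun_sum _ fun i _ => ?_
  rcases le_total (S.time i) t with hi | hi
  · exact ((S.coeff_meas i).mono (𝓕.mono hi)).mul
      (((hM _).mono (𝓕.mono (min_le_right _ _))).sub ((hM _).mono (𝓕.mono (min_le_right _ _))))
  · simp only [min_eq_right hi, min_eq_right (hi.trans (S.time_mono i.le_succ)), sub_self,
      mul_zero]
    exact stronglyMeasurable_const

lemma memLp_coeff_top (i : ℕ) : MemLp (S.coeff i) ∞ P :=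
  have ⟨C, hC⟩ := S.coeff_bdd
  memLp_top_of_bound ((S.coeff_meas i).mono (𝓕.le _)).aestronglyMeasurable C
    (ae_of_all _ (hC i))

lemma memLp_integral (hM : ∀ t, MemLp (M t) 2 P) (t : ℝ≥0) : MemLp (S.integral M t) 2 P :=
  memLp_finsetSum _ fun i _ => ((hM _).sub (hM _)).mul (S.memLp_coeff_top i)

lemma time_le_or_le_time (hS : ∀ i ≤ S.n, S.time i ∉ Set.Ioo u v) {i : ℕ} (hi : i ≤ S.n) :
    S.time i ≤ u ∨ v ≤ S.time i :=
  (le_or_gt (S.time i) u).imp_right fun h => not_lt.1 fun h' => hS i hi ⟨h, h'⟩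

lemma eval_eq_sum_ite (v : ℝ≥0) (ω : Ω) : S.eval v ω = ∑ i ∈ Finset.range S.n,
    if S.time i < v ∧ v ≤ S.time (i + 1) then S.coeff i ω else 0 := by
  simp only [eval, Set.indicator_apply, Set.mem_Ioc, NNReal.coe_lt_coe, NNReal.coe_le_coe]

lemma integral_sub_integral (huv : u ≤ v) (hS : ∀ i ≤ S.n, S.time i ∉ Set.Ioo u v) (ω : Ω) :
    S.integral M v ω - S.integral M u ω = S.eval v ω * (M v ω - M u ω) := by
  rcases huv.eq_or_lt with rfl | huv
  · rw [sub_self, sub_self, mul_zero]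
  rw [integral, integral, eval_eq_sum_ite, ← Finset.sum_sub_distrib, Finset.sum_mul]
  refine Finset.sum_congr rfl fun i hi => ?_
  have hi : i < S.n := Finset.mem_range.1 hi
  have hmono := S.time_mono i.le_succ
  rcases S.time_le_or_le_time hS hi.le with h₀ | h₀ <;>
    rcases S.time_le_or_le_time hS (Nat.succ_le_of_lt hi) with h₁ | h₁
  · rw [if_neg fun h => (h.2.trans h₁).not_gt huv, min_eq_left h₀, min_eq_left h₁,
      min_eq_left (h₀.trans huv.le), min_eq_left (h₁.trans huv.le)]
    ring
  · rw [if_pos ⟨h₀.trans_lt huv, h₁⟩, min_eq_left h₀, min_eq_right h₁,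
      min_eq_left (h₀.trans huv.le), min_eq_right (huv.le.trans h₁)]
    ring
  · exact absurd ((h₀.trans hmono).trans h₁) huv.not_ge
  · rw [if_neg fun h => h.1.not_ge h₀, min_eq_right h₀, min_eq_right h₁,
      min_eq_right (huv.le.trans h₀), min_eq_right (huv.le.trans h₁)]
    ring

lemma eval_eq_of_mem_Ioc (hS : ∀ i ≤ S.n, S.time i ∉ Set.Ioo u v) {r : ℝ}
    (hr : r ∈ Set.Ioc (u : ℝ) v) (ω : Ω) : S.eval r ω = S.eval v ω := by
  lift r to ℝ≥0 using u.2.trans hr.1.le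
  obtain ⟨hur, hrv⟩ : u < r ∧ r ≤ v := mod_cast hr
  simp only [eval_eq_sum_ite]
  refine Finset.sum_congr rfl fun i hi => if_congr (and_congr ?_ ?_) rfl rfl
  · rcases S.time_le_or_le_time hS (Finset.mem_range.1 hi).le with h | h
    · exact iff_of_true (h.trans_lt hur) (h.trans_lt (hur.trans_le hrv))
    · exact iff_of_false (hrv.trans h).not_gt h.not_gt
  · rcases S.time_le_or_le_time hS (Nat.succ_le_of_lt (Finset.mem_range.1 hi)) with h | h
    · exact iff_of_false (h.trans_lt hur).not_ge (h.trans_lt (hur.trans_le hrv)).not_ge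
    · exact iff_of_true (hrv.trans h) h

lemma stronglyMeasurable_eval (hS : ∀ i ≤ S.n, S.time i ∉ Set.Ioo u v) :
    StronglyMeasurable[𝓕 u] (S.eval v) := by
  refine Finset.stronglyMeasurable_fun_sum _ fun i hi => ?_
  simp only [Set.indicator_apply]
  split_ifs with h
  · refine (S.coeff_meas i).mono (𝓕.mono ?_)
    exact (S.time_le_or_le_time hS (Finset.mem_range.1 hi).le).elim id
      fun h' => absurd (NNReal.coe_lt_coe.1 h.1) h'.not_gt
  · exact stronglyMeasurable_const

end SimplePredictable

variable [IsFiniteMeasure P]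

lemma IsQuadVarMajorant.lintegral_enorm_sq_integral_sub_le_add (h : IsQuadVarMajorant 𝓕 P M V)
    (hV : ∀ᵐ ω ∂P, MonotoneOn (fun t => V t ω) (Set.Iic s))
    (hV_cont : ∀ᵐ ω ∂P, ContinuousOn (fun t => V t ω) (Set.Iic s))
    (S S' : SimplePredictable 𝓕) (huv : u ≤ v) (hvs : v ≤ s)
    (hS : ∀ i ≤ S.n, S.time i ∉ Set.Ioo u v) (hS' : ∀ i ≤ S'.n, S'.time i ∉ Set.Ioo u v) :
    ∫⁻ ω, ‖S.integral M v ω - S'.integral M v ω‖ₑ ^ 2 ∂P ≤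
      ∫⁻ ω, ‖S.integral M u ω - S'.integral M u ω‖ₑ ^ 2 ∂P +
        ∫⁻ ω, ∫⁻ r in Set.Ioc (u : ℝ) v, ‖S.eval r ω - S'.eval r ω‖ₑ ^ 2
          ∂(stieltjesMeasure (fun t => V t ω) s) ∂P := by
  have hint : ∀ ω, S.integral M v ω - S'.integral M v ω =
      (S.integral M u ω - S'.integral M u ω) +
        (S.eval v ω - S'.eval v ω) * (M v ω - M u ω) := fun ω => by
    linear_combination S.integral_sub_integral (M := M) huv hS ω -
      S'.integral_sub_integral (M := M) huv hS' ω
  have hη : StronglyMeasurable[𝓕 u] fun ω => S.eval v ω - S'.eval v ω :=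
    (S.stronglyMeasurable_eval hS).sub (S'.stronglyMeasurable_eval hS')
  have hη_top : MemLp (fun ω => S.eval v ω - S'.eval v ω) ∞ P :=
    have ⟨C, hC⟩ := S.exists_abs_eval_le
    have ⟨C', hC'⟩ := S'.exists_abs_eval_le
    memLp_top_of_bound (hη.mono (𝓕.le u)).aestronglyMeasurable (C + C')
      (ae_of_all _ fun ω => (norm_sub_le _ _).trans (add_le_add (hC v ω) (hC' v ω)))
  have hVuv : ∀ᵐ ω ∂P, V u ω ≤ V v ω := hV.mono fun ω hω => hω (huv.trans hvs) hvs huv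
  simp_rw [hint]
  refine (h.lintegral_enorm_sq_add_mul_sub_le huv hVuv
    ((S.stronglyMeasurable_integral h.martingale.stronglyAdapted u).sub
      (S'.stronglyMeasurable_integral h.martingale.stronglyAdapted u))
    ((S.memLp_integral h.memLp u).sub (S'.memLp_integral h.memLp u)) hη hη_top).trans_eq ?_
  refine congrArg₂ _ rfl (lintegral_congr_ae ?_)
  filter_upwards [hV, hV_cont] with ω hω hω_cont
  rw [setLIntegral_congr_fun measurableSet_Ioc fun r hr => by
    rw [S.eval_eq_of_mem_Ioc hS hr, S'.eval_eq_of_mem_Ioc hS' hr], setLIntegral_const,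
    stieltjesMeasure_Ioc hω hω_cont huv hvs]

theorem IsQuadVarMajorant.lintegral_enorm_sq_integral_sub_le (h : IsQuadVarMajorant 𝓕 P M V)
    (hV : ∀ᵐ ω ∂P, MonotoneOn (fun t => V t ω) (Set.Iic s))
    (hV_cont : ∀ᵐ ω ∂P, ContinuousOn (fun t => V t ω) (Set.Iic s))
    (S S' : SimplePredictable 𝓕) :
    ∫⁻ ω, ‖S.integral M s ω - S'.integral M s ω‖ₑ ^ 2 ∂P ≤
      ∫⁻ ω, ∫⁻ r, ‖S.eval r ω - S'.eval r ω‖ₑ ^ 2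
        ∂(stieltjesMeasure (fun t => V t ω) s) ∂P := by
  let X (t : ℝ≥0) : ℝ≥0∞ := ∫⁻ ω, ‖S.integral M t ω - S'.integral M t ω‖ₑ ^ 2 ∂P
  let E (u v : ℝ≥0) (ω : Ω) : ℝ≥0∞ := ∫⁻ r in Set.Ioc (u : ℝ) v,
    ‖S.eval r ω - S'.eval r ω‖ₑ ^ 2 ∂(stieltjesMeasure (fun t => V t ω) s)
  have hE_add : ∀ ⦃u v w⦄, u ≤ v → v ≤ w →
      ∫⁻ ω, E u v ω ∂P + ∫⁻ ω, E v w ω ∂P ≤ ∫⁻ ω, E u w ω ∂P := fun u v w huv hvw => by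
    refine (le_lintegral_add _ _).trans_eq (lintegral_congr fun ω => ?_)
    rw [← lintegral_union measurableSet_Ioc (Set.Ioc_disjoint_Ioc_of_le le_rfl),
      Set.Ioc_union_Ioc_eq_Ioc (NNReal.coe_le_coe.2 huv) (NNReal.coe_le_coe.2 hvw)]
  have hX : s ≤ s → X s ≤ X 0 + ∫⁻ ω, E 0 s ω ∂P := by
    refine rel_of_forall_notMem_Ioo (R := fun u v => v ≤ s → X v ≤ X u + ∫⁻ ω, E u v ω ∂P)
      (fun u v w huv hvw hXuv hXvw hws => ?_)
      ((Finset.range (S.n + 1)).image S.time ∪ (Finset.range (S'.n + 1)).image S'.time)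
      (fun u v huv hF hvs => ?_) (zero_le : 0 ≤ s)
    · calc X w ≤ X v + ∫⁻ ω, E v w ω ∂P := hXvw hws
        _ ≤ X u + ∫⁻ ω, E u v ω ∂P + ∫⁻ ω, E v w ω ∂P := by gcongr; exact hXuv (hvw.trans hws)
        _ ≤ X u + ∫⁻ ω, E u w ω ∂P := by rw [add_assoc]; gcongr; exact hE_add huv hvw
    · exact h.lintegral_enorm_sq_integral_sub_le_add hV hV_cont S S' huv hvs
        (fun i hi => hF _ (Finset.mem_union_left _
          (Finset.mem_image_of_mem _ (Finset.mem_range_succ_iff.2 hi))))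
        (fun i hi => hF _ (Finset.mem_union_right _
          (Finset.mem_image_of_mem _ (Finset.mem_range_succ_iff.2 hi))))
  have hX_zero : X 0 = 0 := by simp [X, SimplePredictable.integral_zero_time]
  refine (hX le_rfl).trans ?_
  rw [hX_zero, zero_add]
  exact lintegral_mono fun ω => setLIntegral_le_lintegral _ _

end ElementaryIntegral

section Lintegral

lemma eLpNorm_two_sq {α : Type*} {mα : MeasurableSpace α} {μ : Measure α} (f : α → ℝ) :
    eLpNorm f 2 μ ^ 2 = ∫⁻ x, ‖f x‖ₑ ^ 2 ∂μ := by
  simpa using eLpNorm_nnreal_pow_eq_lintegral (p := 2) (f := f) (μ := μ) two_ne_zero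

lemma tendsto_eLpNorm_two_zero_iff {α κ : Type*} {mα : MeasurableSpace α} {μ : Measure α}
    {l : Filter κ} {f : κ → α → ℝ} :
    Tendsto (fun n => eLpNorm (f n) 2 μ) l (𝓝 0) ↔
      Tendsto (fun n => ∫⁻ x, ‖f n x‖ₑ ^ 2 ∂μ) l (𝓝 0) := by
  simp_rw [← eLpNorm_two_sq]
  refine ⟨fun h => by simpa using ENNReal.Tendsto.pow (n := 2) h, fun h => ?_⟩
  have hsqrt (x : ℝ≥0∞) : (x ^ 2) ^ (1 / 2 : ℝ) = x := by
    rw [← ENNReal.rpow_natCast, ← ENNReal.rpow_mul, Nat.cast_ofNat, mul_one_div_cancel two_ne_zero,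
      ENNReal.rpow_one]
  simpa only [hsqrt, ENNReal.zero_rpow_of_pos one_half_pos] using h.ennrpow_const (1 / 2)

lemma tendsto_ofReal_sq_mul {C : ℝ≥0∞} (hC : C ≠ ∞) :
    Tendsto (fun δ : ℝ => ENNReal.ofReal (δ ^ 2) * C) (𝓝[>] 0) (𝓝 0) := by
  have : Tendsto (fun δ : ℝ => ENNReal.ofReal (δ ^ 2)) (𝓝[>] 0) (𝓝 (ENNReal.ofReal (0 ^ 2))) :=
    ((ENNReal.continuous_ofReal.comp (continuous_pow 2)).tendsto 0).mono_left nhdsWithin_le_nhds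
  simpa using ENNReal.Tendsto.mul_const this (Or.inr hC)

lemma exists_pos_ofReal_sq_mul_le {C ε : ℝ≥0∞} (hC : C ≠ ∞) (hε : 0 < ε) :
    ∃ δ : ℝ, 0 < δ ∧ ENNReal.ofReal (δ ^ 2) * C ≤ ε :=
  have ⟨δ, hδ, hδ_pos⟩ :=
    (((tendsto_ofReal_sq_mul hC).eventually (ge_mem_nhds hε)).and self_mem_nhdsWithin).exists
  ⟨δ, hδ_pos, hδ⟩

lemma lintegral_enorm_sq_le_of_abs_le {α : Type*} {mα : MeasurableSpace α} {μ : Measure α}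
    {f : α → ℝ} {δ : ℝ} (hf : ∀ᵐ x ∂μ, |f x| ≤ δ) :
    ∫⁻ x, ‖f x‖ₑ ^ 2 ∂μ ≤ ENNReal.ofReal (δ ^ 2) * μ Set.univ := by
  rw [← lintegral_const]
  refine lintegral_mono_ae (hf.mono fun x hx => ?_)
  rw [enorm_sq_eq_ofReal]
  exact ENNReal.ofReal_le_ofReal (sq_le_sq' (abs_le.1 hx).1 (abs_le.1 hx).2)

lemma lintegral_enorm_sq_sub_le_of_abs_le {α : Type*} {mα : MeasurableSpace α} {μ : Measure α}
    {f g h : α → ℝ} {δ : ℝ} (hg : ∀ᵐ x ∂μ, |g x - h x| ≤ δ) :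
    ∫⁻ x, ‖f x - g x‖ₑ ^ 2 ∂μ ≤
      2 * ∫⁻ x, ‖f x - h x‖ₑ ^ 2 ∂μ + ENNReal.ofReal (δ ^ 2) * (2 * μ Set.univ) := by
  have hle : ∀ᵐ x ∂μ, ‖f x - g x‖ₑ ^ 2 ≤
      2 * ‖f x - h x‖ₑ ^ 2 + 2 * ENNReal.ofReal (δ ^ 2) := hg.mono fun x hx => by
    rw [enorm_sq_eq_ofReal, enorm_sq_eq_ofReal, ← ENNReal.ofReal_ofNat 2,
      ← ENNReal.ofReal_mul zero_le_two, ← ENNReal.ofReal_mul zero_le_two,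
      ← ENNReal.ofReal_add (by positivity) (by positivity)]
    refine ENNReal.ofReal_le_ofReal ?_
    have hsq : (g x - h x) ^ 2 ≤ δ ^ 2 := sq_le_sq' (abs_le.1 hx).1 (abs_le.1 hx).2
    nlinarith [sq_nonneg ((f x - h x) + (g x - h x))]
  refine (lintegral_mono_ae hle).trans_eq ?_
  rw [lintegral_add_right _ measurable_const, lintegral_const_mul' _ _ ENNReal.ofNat_ne_top,
    lintegral_const]
  ring

end Lintegral

section ItoIntegral

variable {Ω : Type*} {mΩ : MeasurableSpace Ω} {P : Measure Ω}
  {𝓕 : Filtration ℝ≥0 mΩ} {M V : ℝ≥0 → Ω → ℝ} {s : ℝ≥0} {H : ℝ → Ω → ℝ}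
  {D : ℕ → SimplePredictable 𝓕} {I : Ω → ℝ}

lemma SimplePredictable.ae_abs_eval_sub_le {S : SimplePredictable 𝓕} {A : ℝ≥0 → ℝ} {δ : ℝ}
    (hS : ∀ p ∈ Set.Ioc 0 (s : ℝ) ×ˢ (Set.univ : Set Ω),
      dist (Function.uncurry H p) (Function.uncurry S.eval p) < δ) (ω : Ω) :
    ∀ᵐ r ∂(stieltjesMeasure A s), |S.eval r ω - H r ω| ≤ δ := by
  filter_upwards [ae_stieltjesMeasure_mem_Ioc A s] with r hr
  have := hS (r, ω) ⟨hr, trivial⟩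
  rw [dist_comm, Real.dist_eq] at this
  exact this.le

namespace IsQuadVarMajorant

lemma lintegral_ofReal_sub_ne_top (h : IsQuadVarMajorant 𝓕 P M V) [IsFiniteMeasure P] :
    ∫⁻ ω, ENNReal.ofReal (V s ω - V 0 ω) ∂P ≠ ∞ :=
  ((h.integrable s).sub (h.integrable 0)).lintegral_lt_top.ne

lemma tendsto_lintegral_eval_sub (h : IsQuadVarMajorant 𝓕 P M V) [IsFiniteMeasure P]
    (hV : ∀ᵐ ω ∂P, MonotoneOn (fun t => V t ω) (Set.Iic s))
    (hV_cont : ∀ᵐ ω ∂P, ContinuousOn (fun t => V t ω) (Set.Iic s))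
    (hD : TendstoUniformlyOn (fun n => Function.uncurry (D n).eval) (Function.uncurry H) atTop
      (Set.Ioc 0 (s : ℝ) ×ˢ Set.univ)) :
    Tendsto (fun n => ∫⁻ ω, ∫⁻ r, ‖(D n).eval r ω - H r ω‖ₑ ^ 2
      ∂(stieltjesMeasure (fun t => V t ω) s) ∂P) atTop (𝓝 0) := by
  refine ENNReal.tendsto_nhds_zero.2 fun ε hε => ?_
  obtain ⟨δ, hδ, hδε⟩ := exists_pos_ofReal_sq_mul_le (h.lintegral_ofReal_sub_ne_top (s := s)) hε
  filter_upwards [Metric.tendstoUniformlyOn_iff.1 hD δ hδ] with n hn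
  refine le_trans ?_ hδε
  rw [← lintegral_const_mul' _ _ ENNReal.ofReal_ne_top]
  refine lintegral_mono_ae ?_
  filter_upwards [hV, hV_cont] with ω hω hω_cont
  rw [← stieltjesMeasure_univ hω hω_cont]
  exact lintegral_enorm_sq_le_of_abs_le (SimplePredictable.ae_abs_eval_sub_le hn ω)

lemma lintegral_enorm_sq_integral_sub_le_two_mul_add (h : IsQuadVarMajorant 𝓕 P M V)
    [IsFiniteMeasure P] (hV : ∀ᵐ ω ∂P, MonotoneOn (fun t => V t ω) (Set.Iic s))
    (hV_cont : ∀ᵐ ω ∂P, ContinuousOn (fun t => V t ω) (Set.Iic s))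
    (S : SimplePredictable 𝓕) {S' : SimplePredictable 𝓕} {δ : ℝ}
    (hS' : ∀ p ∈ Set.Ioc 0 (s : ℝ) ×ˢ (Set.univ : Set Ω),
      dist (Function.uncurry H p) (Function.uncurry S'.eval p) < δ) :
    ∫⁻ ω, ‖S.integral M s ω - S'.integral M s ω‖ₑ ^ 2 ∂P ≤
      2 * ∫⁻ ω, ∫⁻ r, ‖S.eval r ω - H r ω‖ₑ ^ 2 ∂(stieltjesMeasure (fun t => V t ω) s) ∂P +
        ENNReal.ofReal (δ ^ 2) * (2 * ∫⁻ ω, ENNReal.ofReal (V s ω - V 0 ω) ∂P) := by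
  have hV_meas : AEMeasurable (fun ω => ENNReal.ofReal (V s ω - V 0 ω)) P :=
    ((h.integrable s).sub (h.integrable 0)).aemeasurable.ennreal_ofReal
  refine (h.lintegral_enorm_sq_integral_sub_le hV hV_cont S S').trans ?_
  rw [← lintegral_const_mul' _ _ ENNReal.ofNat_ne_top,
    ← lintegral_const_mul' _ _ ENNReal.ofNat_ne_top,
    ← lintegral_const_mul' _ _ ENNReal.ofReal_ne_top,
    ← lintegral_add_right' _ ((hV_meas.const_mul _).const_mul _)]
  refine lintegral_mono_ae ?_
  filter_upwards [hV, hV_cont] with ω hω hω_cont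
  rw [← stieltjesMeasure_univ hω hω_cont]
  exact lintegral_enorm_sq_sub_le_of_abs_le (SimplePredictable.ae_abs_eval_sub_le hS' ω)

lemma lintegral_enorm_sq_integral_sub_limit_le (h : IsQuadVarMajorant 𝓕 P M V)
    [IsFiniteMeasure P] (hV : ∀ᵐ ω ∂P, MonotoneOn (fun t => V t ω) (Set.Iic s))
    (hV_cont : ∀ᵐ ω ∂P, ContinuousOn (fun t => V t ω) (Set.Iic s))
    (hD : TendstoUniformlyOn (fun n => Function.uncurry (D n).eval) (Function.uncurry H) atTop
      (Set.Ioc 0 (s : ℝ) ×ˢ Set.univ))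
    (hI : ∀ᵐ ω ∂P, Tendsto (fun n => (D n).integral M s ω) atTop (𝓝 (I ω)))
    (S : SimplePredictable 𝓕) :
    ∫⁻ ω, ‖S.integral M s ω - I ω‖ₑ ^ 2 ∂P ≤
      2 * ∫⁻ ω, ∫⁻ r, ‖S.eval r ω - H r ω‖ₑ ^ 2 ∂(stieltjesMeasure (fun t => V t ω) s) ∂P := by
  have hmeas (S : SimplePredictable 𝓕) : AEStronglyMeasurable (S.integral M s) P :=
    (S.memLp_integral h.memLp s).aestronglyMeasurable
  have hfatou : ∫⁻ ω, ‖S.integral M s ω - I ω‖ₑ ^ 2 ∂P ≤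
      liminf (fun n => ∫⁻ ω, ‖S.integral M s ω - (D n).integral M s ω‖ₑ ^ 2 ∂P) atTop := by
    refine (lintegral_congr_ae ?_).trans_le
      (lintegral_liminf_le' fun n => ((hmeas S).sub (hmeas (D n))).enorm.pow_const 2)
    filter_upwards [hI] with ω hω
    exact (ENNReal.Tendsto.pow (tendsto_const_nhds.sub hω).enorm).liminf_eq.symm
  refine hfatou.trans (ENNReal.le_of_forall_pos_le_add fun ε hε _ => ?_)
  obtain ⟨δ, hδ, hδε⟩ := exists_pos_ofReal_sq_mul_le
    (ENNReal.mul_ne_top (a := 2) ENNReal.ofNat_ne_top (h.lintegral_ofReal_sub_ne_top (s := s)))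
    (ENNReal.coe_pos.2 hε)
  refine liminf_le_of_frequently_le' (Eventually.frequently ?_)
  filter_upwards [Metric.tendstoUniformlyOn_iff.1 hD δ hδ] with n hn
  exact (h.lintegral_enorm_sq_integral_sub_le_two_mul_add hV hV_cont S hn).trans (by gcongr)

lemma tendsto_eLpNorm_integral_sub_limit (h : IsQuadVarMajorant 𝓕 P M V)
    [IsFiniteMeasure P] (hV : ∀ᵐ ω ∂P, MonotoneOn (fun t => V t ω) (Set.Iic s))
    (hV_cont : ∀ᵐ ω ∂P, ContinuousOn (fun t => V t ω) (Set.Iic s))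
    (hD : TendstoUniformlyOn (fun n => Function.uncurry (D n).eval) (Function.uncurry H) atTop
      (Set.Ioc 0 (s : ℝ) ×ˢ Set.univ))
    (hI : ∀ᵐ ω ∂P, Tendsto (fun n => (D n).integral M s ω) atTop (𝓝 (I ω)))
    {S : ℕ → SimplePredictable 𝓕}
    (hS : Tendsto (fun n => ∫⁻ ω, ∫⁻ r, ‖(S n).eval r ω - H r ω‖ₑ ^ 2
      ∂(stieltjesMeasure (fun t => V t ω) s) ∂P) atTop (𝓝 0)) :
    Tendsto (fun n => eLpNorm (fun ω => (S n).integral M s ω - I ω) 2 P) atTop (𝓝 0) := by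
  rw [tendsto_eLpNorm_two_zero_iff]
  refine tendsto_of_tendsto_of_tendsto_of_le_of_le tendsto_const_nhds ?_ (fun _ => zero_le)
    fun n => h.lintegral_enorm_sq_integral_sub_limit_le hV hV_cont hD hI (S n)
  simpa using ENNReal.Tendsto.const_mul (a := 2) hS (Or.inr ENNReal.ofNat_ne_top)

theorem isItoIntegral_of_tendsto (h : IsQuadVarMajorant 𝓕 P M V)
    [IsFiniteMeasure P] (hV : ∀ᵐ ω ∂P, MonotoneOn (fun t => V t ω) (Set.Iic s))
    (hV_cont : ∀ᵐ ω ∂P, ContinuousOn (fun t => V t ω) (Set.Iic s))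
    (hD : TendstoUniformlyOn (fun n => Function.uncurry (D n).eval) (Function.uncurry H) atTop
      (Set.Ioc 0 (s : ℝ) ×ˢ Set.univ))
    (hI : ∀ᵐ ω ∂P, Tendsto (fun n => (D n).integral M s ω) atTop (𝓝 (I ω))) :
    IsItoIntegral 𝓕 P M V H s I := by
  have hD_int := h.tendsto_lintegral_eval_sub hV hV_cont hD
  have hlim := h.tendsto_eLpNorm_integral_sub_limit hV hV_cont hD hI hD_int
  have hD_L2 (n : ℕ) := (D n).memLp_integral h.memLp s
  have hI_meas := aestronglyMeasurable_of_tendsto_ae atTop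
    (fun n => (hD_L2 n).aestronglyMeasurable) hI
  obtain ⟨n, hn⟩ := (hlim.eventually (gt_mem_nhds ENNReal.zero_lt_top)).exists
  refine ⟨?_, D, hD_int, hlim⟩
  simpa using (hD_L2 n).sub ⟨(hD_L2 n).aestronglyMeasurable.sub hI_meas, hn⟩

theorem ae_eq_of_isItoIntegral (h : IsQuadVarMajorant 𝓕 P M V)
    [IsFiniteMeasure P] (hV : ∀ᵐ ω ∂P, MonotoneOn (fun t => V t ω) (Set.Iic s))
    (hV_cont : ∀ᵐ ω ∂P, ContinuousOn (fun t => V t ω) (Set.Iic s))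
    (hD : TendstoUniformlyOn (fun n => Function.uncurry (D n).eval) (Function.uncurry H) atTop
      (Set.Ioc 0 (s : ℝ) ×ˢ Set.univ))
    (hI : ∀ᵐ ω ∂P, Tendsto (fun n => (D n).integral M s ω) atTop (𝓝 (I ω))) {J : Ω → ℝ}
    (hJ : IsItoIntegral 𝓕 P M V H s J) : J =ᵐ[P] I := by
  obtain ⟨hJ_L2, S, hS, hSJ⟩ := hJ
  have hI_meas := (h.isItoIntegral_of_tendsto hV hV_cont hD hI).1.aestronglyMeasurable
  have hSI := h.tendsto_eLpNorm_integral_sub_limit hV hV_cont hD hI hS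
  have hS_meas (n : ℕ) := ((S n).memLp_integral h.memLp s).aestronglyMeasurable
  exact tendstoInMeasure_ae_unique
    (tendstoInMeasure_of_tendsto_eLpNorm two_ne_zero hS_meas hJ_L2.aestronglyMeasurable hSJ)
    (tendstoInMeasure_of_tendsto_eLpNorm two_ne_zero hS_meas hI_meas hSI)

end IsQuadVarMajorant

end ItoIntegral

section RiemannSums

lemma intervalIntegrable_of_mem_Icc {μ : Measure ℝ} {f : ℝ → ℝ} {a b u v : ℝ}
    (hf : IntervalIntegrable f μ a b) (hu : u ∈ Set.Icc a b) (hv : v ∈ Set.Icc a b) :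
    IntervalIntegrable f μ u v :=
  hf.mono_set (Set.uIcc_subset_uIcc (Set.Icc_subset_uIcc hu) (Set.Icc_subset_uIcc hv))

/-- The `i`-th point of the uniform partition of `[0, s]` into `n + 1` intervals. -/
noncomputable def gridPoint (s : ℝ≥0) (n i : ℕ) : ℝ≥0 := i * (s / (n + 1))

variable {s : ℝ≥0} {n i : ℕ}

lemma gridPoint_mono (s : ℝ≥0) (n : ℕ) : Monotone (gridPoint s n) := fun i j hij => by
  unfold gridPoint
  gcongr

lemma gridPoint_zero (s : ℝ≥0) (n : ℕ) : gridPoint s n 0 = 0 := by simp [gridPoint]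

lemma gridPoint_last (s : ℝ≥0) (n : ℕ) : gridPoint s n (n + 1) = s := by
  unfold gridPoint
  push_cast
  field_simp

lemma gridPoint_le (hi : i ≤ n + 1) : gridPoint s n i ≤ s :=
  (gridPoint_mono s n hi).trans_eq (gridPoint_last s n)

lemma gridPoint_coe_le_succ (s : ℝ≥0) (n i : ℕ) :
    (gridPoint s n i : ℝ) ≤ gridPoint s n (i + 1) :=
  NNReal.coe_le_coe.2 (gridPoint_mono s n i.le_succ)

lemma gridPoint_coe_mem_Icc (hi : i ≤ n + 1) : (gridPoint s n i : ℝ) ∈ Set.Icc 0 (s : ℝ) :=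
  ⟨NNReal.coe_nonneg _, NNReal.coe_le_coe.2 (gridPoint_le hi)⟩

lemma gridPoint_succ_sub (s : ℝ≥0) (n i : ℕ) :
    (gridPoint s n (i + 1) : ℝ) - gridPoint s n i = s / (n + 1) := by
  simp only [gridPoint, NNReal.coe_mul, NNReal.coe_natCast, NNReal.coe_div, NNReal.coe_add,
    NNReal.coe_one, Nat.cast_add_one]
  ring

lemma tendsto_div_add_one_atTop (x : ℝ) :
    Tendsto (fun n : ℕ => x / (n + 1)) atTop (𝓝 0) := by
  simpa only [Function.comp_def, Nat.cast_add_one] using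
    (tendsto_const_div_atTop_nhds_zero_nat x).comp (tendsto_add_atTop_nat 1)

lemma exists_mem_Ioc_gridPoint (n : ℕ) {r : ℝ} (hr : r ∈ Set.Ioc (0 : ℝ) s) :
    ∃ i ≤ n, r ∈ Set.Ioc (gridPoint s n i : ℝ) (gridPoint s n (i + 1)) := by
  have hmono : Monotone fun i => (gridPoint s n i : ℝ) := fun i j hij =>
    NNReal.coe_le_coe.2 (gridPoint_mono s n hij)
  have hunion := hmono.biUnion_Ico_Ioc_map_succ 0 (n + 1)
  simp only [gridPoint_zero, gridPoint_last, NNReal.coe_zero] at hunion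
  obtain ⟨i, hi, hri⟩ := Set.mem_iUnion₂.1 (hunion.symm ▸ hr)
  exact ⟨i, Nat.lt_succ_iff.1 hi.2, hri⟩

lemma eventually_abs_sub_le_of_mem_Icc_gridPoint {f : ℝ → ℝ} (hf : ContinuousOn f (Set.Icc 0 s))
    {ε : ℝ} (hε : 0 < ε) : ∀ᶠ n : ℕ in atTop, ∀ i ≤ n,
      ∀ x ∈ Set.Icc (gridPoint s n i : ℝ) (gridPoint s n (i + 1)),
      ∀ y ∈ Set.Icc (gridPoint s n i : ℝ) (gridPoint s n (i + 1)), |f x - f y| ≤ ε := by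
  obtain ⟨δ, hδ, hfδ⟩ := Metric.uniformContinuousOn_iff.1
    (isCompact_Icc.uniformContinuousOn_of_continuous hf) ε hε
  filter_upwards [(tendsto_div_add_one_atTop s).eventually (gt_mem_nhds hδ)]
    with n hn i hi x hx y hy
  have hsub : Set.Icc (gridPoint s n i : ℝ) (gridPoint s n (i + 1)) ⊆ Set.Icc 0 (s : ℝ) :=
    Set.Icc_subset_Icc (NNReal.coe_nonneg _) (gridPoint_coe_mem_Icc (Nat.succ_le_succ hi)).2
  refine (hfδ x (hsub hx) y (hsub hy) ((Real.dist_le_of_mem_Icc hx hy).trans_lt ?_)).le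
  rwa [gridPoint_succ_sub]

lemma intervalIntegrable_gridPoint {μ : Measure ℝ} {f : ℝ → ℝ} (hf : IntervalIntegrable f μ 0 s)
    (hi : i ≤ n) : IntervalIntegrable f μ (gridPoint s n i) (gridPoint s n (i + 1)) :=
  intervalIntegrable_of_mem_Icc hf (gridPoint_coe_mem_Icc (hi.trans n.le_succ))
    (gridPoint_coe_mem_Icc (Nat.succ_le_succ hi))

lemma sum_integral_gridPoint {μ : Measure ℝ} {f : ℝ → ℝ} (hf : IntervalIntegrable f μ 0 s)
    (n : ℕ) : ∑ i ∈ Finset.range (n + 1),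
      ∫ r in (gridPoint s n i : ℝ)..gridPoint s n (i + 1), f r ∂μ = ∫ r in (0 : ℝ)..s, f r ∂μ := by
  rw [intervalIntegral.sum_integral_adjacent_intervals (a := fun i => (gridPoint s n i : ℝ))
    fun i hi => intervalIntegrable_gridPoint hf (Nat.lt_succ_iff.1 hi), gridPoint_last,
    gridPoint_zero, NNReal.coe_zero]

theorem tendsto_sum_mul_integral_gridPoint {μ : Measure ℝ} {f g : ℝ → ℝ}
    (hf : IntervalIntegrable f μ 0 s) (hg : ContinuousOn g (Set.Icc 0 s)) {ξ : ℕ → ℕ → ℝ}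
    (hξ : ∀ n i, ξ n i ∈ Set.Icc (gridPoint s n i : ℝ) (gridPoint s n (i + 1))) :
    Tendsto (fun n => ∑ i ∈ Finset.range (n + 1),
        g (ξ n i) * ∫ r in (gridPoint s n i : ℝ)..gridPoint s n (i + 1), f r ∂μ) atTop
      (𝓝 (∫ r in (0 : ℝ)..s, g r * f r ∂μ)) := by
  have hgf : IntervalIntegrable (fun r => g r * f r) μ 0 s :=
    hf.continuousOn_mul (by rwa [Set.uIcc_of_le s.coe_nonneg])
  set L := ∫ r in (0 : ℝ)..s, |f r| ∂μ
  have hL : 0 ≤ L := intervalIntegral.integral_nonneg s.coe_nonneg fun _ _ => abs_nonneg _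
  refine Metric.tendsto_nhds.2 fun ε hε => ?_
  have hδ : 0 < ε / (L + 1) := by positivity
  filter_upwards [eventually_abs_sub_le_of_mem_Icc_gridPoint hg hδ] with n hn
  have hterm : ∀ i ≤ n,
      |g (ξ n i) * (∫ r in (gridPoint s n i : ℝ)..gridPoint s n (i + 1), f r ∂μ) -
        ∫ r in (gridPoint s n i : ℝ)..gridPoint s n (i + 1), g r * f r ∂μ| ≤
      ε / (L + 1) * ∫ r in (gridPoint s n i : ℝ)..gridPoint s n (i + 1), |f r| ∂μ := by
    intro i hi
    have hfi := intervalIntegrable_gridPoint hf hi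
    rw [← intervalIntegral.integral_const_mul, ← intervalIntegral.integral_const_mul,
      ← intervalIntegral.integral_sub (hfi.const_mul _) (intervalIntegrable_gridPoint hgf hi)]
    rw [← Real.norm_eq_abs]
    refine intervalIntegral.norm_integral_le_of_norm_le (gridPoint_coe_le_succ s n i)
      (ae_of_all _ fun r hr => ?_) (hfi.abs.const_mul _)
    rw [← sub_mul, norm_mul, Real.norm_eq_abs, Real.norm_eq_abs]
    exact mul_le_mul_of_nonneg_right (hn i hi _ (hξ n i) r (Set.Ioc_subset_Icc_self hr))
      (abs_nonneg _)
  rw [Real.dist_eq, ← sum_integral_gridPoint hgf n, ← Finset.sum_sub_distrib]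
  calc _ ≤ ∑ i ∈ Finset.range (n + 1),
        ε / (L + 1) * ∫ r in (gridPoint s n i : ℝ)..gridPoint s n (i + 1), |f r| ∂μ :=
        (Finset.abs_sum_le_sum_abs _ _).trans (Finset.sum_le_sum fun i hi =>
          hterm i (Nat.lt_succ_iff.1 (Finset.mem_range.1 hi)))
    _ = ε / (L + 1) * L := by rw [← Finset.mul_sum, sum_integral_gridPoint hf.abs]
    _ < ε := by
        rw [div_mul_eq_mul_div, div_lt_iff₀ (by positivity)]
        nlinarith

lemma continuousOn_comp_toNNReal {x : ℝ≥0 → ℝ} (hx : ContinuousOn x (Set.Iic s)) :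
    ContinuousOn (fun r : ℝ => x r.toNNReal) (Set.Icc 0 s) :=
  hx.comp continuous_real_toNNReal.continuousOn fun _ hr => Real.toNNReal_le_iff_le_coe.2 hr.2

/-- Integration by parts turns the sums with integrator `x` into sums with integrator `H`, which
is absolutely continuous, so that `x` need not have bounded variation. -/
theorem tendsto_sum_gridPoint_mul_sub {H h : ℝ → ℝ} (hh : IntervalIntegrable h volume 0 s)
    (hH : ∀ u ∈ Set.Icc (0 : ℝ) s, ∀ v ∈ Set.Icc (0 : ℝ) s, H v - H u = ∫ r in u..v, h r)
    {x : ℝ≥0 → ℝ} (hx : ContinuousOn x (Set.Iic s)) :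
    Tendsto (fun n => ∑ i ∈ Finset.range (n + 1), H (gridPoint s n i) *
        (x (gridPoint s n (i + 1)) - x (gridPoint s n i))) atTop
      (𝓝 (H s * x s - H 0 * x 0 - ∫ r in (0 : ℝ)..s, x r.toNNReal * h r)) := by
  refine ((tendsto_sum_mul_integral_gridPoint hh (continuousOn_comp_toNNReal hx)
    (ξ := fun n i => gridPoint s n (i + 1))
    fun n i => ⟨gridPoint_coe_le_succ s n i, le_rfl⟩).const_sub _).congr fun n => ?_
  have htelescope := Finset.sum_range_sub (fun i => H (gridPoint s n i) * x (gridPoint s n i))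
    (n + 1)
  rw [gridPoint_last, gridPoint_zero, NNReal.coe_zero] at htelescope
  rw [← htelescope, ← Finset.sum_sub_distrib]
  refine Finset.sum_congr rfl fun i hi => ?_
  have hi : i + 1 ≤ n + 1 := Finset.mem_range.1 hi
  rw [← hH _ (gridPoint_coe_mem_Icc (Nat.le_of_succ_le hi)) _ (gridPoint_coe_mem_Icc hi),
    Real.toNNReal_coe]
  ring

lemma integrable_stieltjesMeasure {A : ℝ≥0 → ℝ} (hA : MonotoneOn A (Set.Iic s))
    (hA_cont : ContinuousOn A (Set.Iic s)) {H : ℝ → ℝ} (hH : ContinuousOn H (Set.Icc 0 s)) :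
    Integrable H (stieltjesMeasure A s) := by
  have := isFiniteMeasure_stieltjesMeasure hA hA_cont
  rw [← Measure.restrict_eq_self_of_ae_mem (ae_stieltjesMeasure_mem_Ioc A s)]
  exact (hH.integrableOn_compact isCompact_Icc).mono_set Set.Ioc_subset_Icc_self

theorem tendsto_sum_gridPoint_integral_stieltjesMeasure {A : ℝ≥0 → ℝ}
    (hA : MonotoneOn A (Set.Iic s)) (hA_cont : ContinuousOn A (Set.Iic s)) {H : ℝ → ℝ}
    (hH : ContinuousOn H (Set.Icc 0 s)) :
    Tendsto (fun n => ∑ i ∈ Finset.range (n + 1), H (gridPoint s n i) *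
        (A (gridPoint s n (i + 1)) - A (gridPoint s n i))) atTop
      (𝓝 (∫ r, H r ∂(stieltjesMeasure A s))) := by
  have := isFiniteMeasure_stieltjesMeasure hA hA_cont
  have hlim := tendsto_sum_mul_integral_gridPoint (μ := stieltjesMeasure A s)
    (f := fun _ => 1) intervalIntegrable_const hH (ξ := fun n i => gridPoint s n i)
    fun n i => ⟨le_rfl, gridPoint_coe_le_succ s n i⟩
  simp only [mul_one, intervalIntegral.integral_of_le s.coe_nonneg] at hlim
  rw [Measure.restrict_eq_self_of_ae_mem (ae_stieltjesMeasure_mem_Ioc A s)] at hlim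
  refine hlim.congr fun n => Finset.sum_congr rfl fun i hi => ?_
  rw [intervalIntegral.integral_of_le (gridPoint_coe_le_succ s n i), setIntegral_const,
    smul_eq_mul, mul_one, measureReal_def, stieltjesMeasure_Ioc hA hA_cont
      (gridPoint_mono s n i.le_succ) (gridPoint_le (Finset.mem_range.1 hi)),
    ENNReal.toReal_ofReal (sub_nonneg.2 (hA (gridPoint_le (Finset.mem_range.1 hi).le)
      (gridPoint_le (Finset.mem_range.1 hi)) (gridPoint_mono s n i.le_succ)))]

end RiemannSums

section GridStep

variable {Ω : Type*} {mΩ : MeasurableSpace Ω} {s : ℝ≥0} {n i : ℕ}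

/-- The deterministic step process with values `H (t_i)` on `(t_i, t_{i+1}]`, for the uniform
partition of `[0, s]` into `n + 1` intervals. -/
noncomputable def gridStep (𝓕 : Filtration ℝ≥0 mΩ) (H : ℝ → ℝ) (s : ℝ≥0) (n : ℕ) :
    SimplePredictable 𝓕 where
  n := n + 1
  time := gridPoint s n
  time_mono := gridPoint_mono s n
  coeff i _ := if i < n + 1 then H (gridPoint s n i) else 0
  coeff_meas _ := stronglyMeasurable_const
  coeff_bdd := by
    refine ⟨∑ j ∈ Finset.range (n + 1), |H (gridPoint s n j)|, fun i _ => ?_⟩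
    split_ifs with hi
    · exact Finset.single_le_sum (f := fun j => |H (gridPoint s n j)|)
        (fun _ _ => abs_nonneg _) (Finset.mem_range.2 hi)
    · simpa using Finset.sum_nonneg fun _ _ => abs_nonneg _

variable (𝓕 : Filtration ℝ≥0 mΩ)

lemma gridStep_integral (H : ℝ → ℝ) (s : ℝ≥0) (n : ℕ) (X : ℝ≥0 → Ω → ℝ) (ω : Ω) :
    (gridStep 𝓕 H s n).integral X s ω = ∑ i ∈ Finset.range (n + 1), H (gridPoint s n i) *
      (X (gridPoint s n (i + 1)) ω - X (gridPoint s n i) ω) := by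
  refine Finset.sum_congr rfl fun i hi => ?_
  have hi : i < n + 1 := Finset.mem_range.1 hi
  simp only [gridStep, hi, if_true, min_eq_left (gridPoint_le (s := s) hi),
    min_eq_left (gridPoint_le (s := s) hi.le)]

lemma gridStep_eval_of_mem_Ioc (H : ℝ → ℝ) (hi : i ≤ n) {r : ℝ}
    (hr : r ∈ Set.Ioc (gridPoint s n i : ℝ) (gridPoint s n (i + 1))) (ω : Ω) :
    (gridStep 𝓕 H s n).eval r ω = H (gridPoint s n i) := by
  have hmono : Monotone fun i => (gridPoint s n i : ℝ) := fun i j hij =>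
    NNReal.coe_le_coe.2 (gridPoint_mono s n hij)
  have hi : i < n + 1 := Nat.lt_succ_iff.2 hi
  refine (Finset.sum_eq_single_of_mem i (Finset.mem_range.2 hi) fun j _ hj =>
    Set.indicator_of_notMem (fun hr' => ?_) _).trans ?_
  · exact Set.disjoint_left.1 (hmono.pairwise_disjoint_on_Ioc_succ hj) hr' hr
  · exact (Set.indicator_of_mem hr _).trans (if_pos hi)

lemma tendstoUniformlyOn_gridStep_eval {H : ℝ → ℝ} (hH : ContinuousOn H (Set.Icc 0 s)) :
    TendstoUniformlyOn (fun n => Function.uncurry (gridStep 𝓕 H s n).eval)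
      (Function.uncurry fun r _ => H r) atTop (Set.Ioc 0 (s : ℝ) ×ˢ Set.univ) := by
  refine Metric.tendstoUniformlyOn_iff.2 fun ε hε => ?_
  filter_upwards [eventually_abs_sub_le_of_mem_Icc_gridPoint hH (half_pos hε)]
    with n hn ⟨r, ω⟩ hr
  obtain ⟨i, hi, hri⟩ := exists_mem_Ioc_gridPoint n hr.1
  rw [Function.uncurry_apply_pair, Function.uncurry_apply_pair,
    gridStep_eval_of_mem_Ioc 𝓕 H hi hri, Real.dist_eq]
  exact (hn i hi r (Set.Ioc_subset_Icc_self hri) _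
    ⟨le_rfl, gridPoint_coe_le_succ s n i⟩).trans_lt (half_lt_self hε)

end GridStep

section Kernel

variable {K : ℝ → ℝ} {T : ℝ}

lemma sub_mem_Icc_of_le {t r : ℝ} (htT : t ≤ T) (hr : r ∈ Set.Icc 0 t) :
    t - r ∈ Set.Icc 0 T :=
  ⟨sub_nonneg.2 hr.2, (sub_le_self t hr.1).trans htT⟩

lemma intervalIntegrable_comp_sub_left (hK : IntervalIntegrable K volume 0 T) {a b t : ℝ}
    (htT : t ≤ T) (ha : a ∈ Set.Icc 0 t) (hb : b ∈ Set.Icc 0 t) :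
    IntervalIntegrable (fun r => K (t - r)) volume a b := by
  simpa only [sub_sub_cancel] using
    (intervalIntegrable_of_mem_Icc hK (sub_mem_Icc_of_le htT ha)
      (sub_mem_Icc_of_le htT hb)).comp_sub_left t

variable {s t : ℝ≥0} {x y : ℝ≥0 → ℝ}

lemma intervalIntegrable_comp_sub_left_mul (hK : IntervalIntegrable K volume 0 T) (htT : t ≤ T)
    (hx : ContinuousOn x (Set.Iic t)) {a b : ℝ} (ha : a ∈ Set.Icc 0 (t : ℝ))
    (hb : b ∈ Set.Icc 0 (t : ℝ)) :
    IntervalIntegrable (fun r => K (t - r) * x r.toNNReal) volume a b :=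
  (intervalIntegrable_comp_sub_left hK htT ha hb).mul_continuousOn
    ((continuousOn_comp_toNNReal hx).mono (Set.uIcc_subset_Icc ha hb))

lemma kernelInt_eq_integral (K : ℝ → ℝ) (s t : ℝ≥0) (r : ℝ) :
    kernelInt K s t r = ∫ u in (s - r : ℝ)..(t - r), K u :=
  intervalIntegral.integral_comp_sub_right K r

lemma intervalIntegrable_kernel_sub (hK : IntervalIntegrable K volume 0 T) (hst : s ≤ t)
    (htT : t ≤ T) : IntervalIntegrable (fun r => K (s - r) - K (t - r)) volume 0 s := by
  have hst' : (s : ℝ) ≤ t := NNReal.coe_le_coe.2 hst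
  exact (intervalIntegrable_comp_sub_left hK (hst'.trans htT) ⟨le_rfl, s.coe_nonneg⟩
    ⟨s.coe_nonneg, le_rfl⟩).sub
    (intervalIntegrable_comp_sub_left hK htT ⟨le_rfl, t.coe_nonneg⟩ ⟨s.coe_nonneg, hst'⟩)

lemma kernelInt_sub_kernelInt (hK : IntervalIntegrable K volume 0 T)
    (hst : s ≤ t) (htT : t ≤ T) {u v : ℝ} (hu : u ∈ Set.Icc 0 (s : ℝ))
    (hv : v ∈ Set.Icc 0 (s : ℝ)) :
    kernelInt K s t v - kernelInt K s t u = ∫ r in u..v, (K (s - r) - K (t - r)) := by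
  have hst' : (s : ℝ) ≤ t := NNReal.coe_le_coe.2 hst
  have hsT := hst'.trans htT
  have hut : u ∈ Set.Icc 0 (t : ℝ) := ⟨hu.1, hu.2.trans hst'⟩
  have hvt : v ∈ Set.Icc 0 (t : ℝ) := ⟨hv.1, hv.2.trans hst'⟩
  have hsv := sub_mem_Icc_of_le hsT hv
  have hsu := sub_mem_Icc_of_le hsT hu
  rw [kernelInt_eq_integral, kernelInt_eq_integral,
    intervalIntegral.integral_interval_sub_interval_comm
      (intervalIntegrable_of_mem_Icc hK hsv (sub_mem_Icc_of_le htT hvt))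
      (intervalIntegrable_of_mem_Icc hK hsu (sub_mem_Icc_of_le htT hut))
      (intervalIntegrable_of_mem_Icc hK hsv hsu),
    intervalIntegral.integral_sub (intervalIntegrable_comp_sub_left hK hsT hu hv)
      (intervalIntegrable_comp_sub_left hK htT hut hvt),
    intervalIntegral.integral_comp_sub_left, intervalIntegral.integral_comp_sub_left]

lemma continuousOn_kernelInt (hK : IntervalIntegrable K volume 0 T) (hst : s ≤ t) (htT : t ≤ T) :
    ContinuousOn (kernelInt K s t) (Set.Icc 0 s) := by
  have hint := (intervalIntegrable_iff' (by simp)).1 (intervalIntegrable_kernel_sub hK hst htT)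
  have hprim := intervalIntegral.continuousOn_primitive_interval hint
  rw [Set.uIcc_of_le s.coe_nonneg] at hprim
  refine (hprim.const_add (kernelInt K s t 0)).congr fun r hr => ?_
  exact eq_add_of_sub_eq' (kernelInt_sub_kernelInt hK hst htT ⟨le_rfl, s.coe_nonneg⟩ hr)

/-- The integral `∫_0^s ∫_s^t K(u - r) du dx_r` against a continuous path `x`, not necessarily of
bounded variation, defined through integration by parts. -/
noncomputable def kernelPathIntegral (K : ℝ → ℝ) (s t : ℝ≥0) (x : ℝ≥0 → ℝ) : ℝ :=
  kernelInt K s t s * x s - kernelInt K s t 0 * x 0 -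
    ∫ r in (0 : ℝ)..s, x r.toNNReal * (K (s - r) - K (t - r))

lemma tendsto_sum_kernelPathIntegral (hK : IntervalIntegrable K volume 0 T)
    (hst : s ≤ t) (htT : t ≤ T) (hx : ContinuousOn x (Set.Iic s)) :
    Tendsto (fun n => ∑ i ∈ Finset.range (n + 1), kernelInt K s t (gridPoint s n i) *
        (x (gridPoint s n (i + 1)) - x (gridPoint s n i))) atTop
      (𝓝 (kernelPathIntegral K s t x)) :=
  tendsto_sum_gridPoint_mul_sub (intervalIntegrable_kernel_sub hK hst htT)
    (fun _ hu _ hv => kernelInt_sub_kernelInt hK hst htT hu hv) hx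

lemma integral_kernelInt_stieltjesMeasure (hK : IntervalIntegrable K volume 0 T)
    (hst : s ≤ t) (htT : t ≤ T) (hx : MonotoneOn x (Set.Iic s))
    (hx_cont : ContinuousOn x (Set.Iic s)) :
    ∫ r, kernelInt K s t r ∂(stieltjesMeasure x s) = kernelPathIntegral K s t x :=
  tendsto_nhds_unique
    (tendsto_sum_gridPoint_integral_stieltjesMeasure hx hx_cont (continuousOn_kernelInt hK hst htT))
    (tendsto_sum_kernelPathIntegral hK hst htT hx_cont)

lemma kernelPathIntegral_mul_add_mul (hK : IntervalIntegrable K volume 0 T)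
    (hst : s ≤ t) (htT : t ≤ T) (hx : ContinuousOn x (Set.Iic s))
    (hy : ContinuousOn y (Set.Iic s)) (b c : ℝ) :
    kernelPathIntegral K s t (fun r => b * x r + c * y r) =
      b * kernelPathIntegral K s t x + c * kernelPathIntegral K s t y := by
  refine tendsto_nhds_unique (tendsto_sum_kernelPathIntegral hK hst htT
    ((hx.const_mul b).add (hy.const_mul c)))
    ((((tendsto_sum_kernelPathIntegral hK hst htT hx).const_mul b).add
      ((tendsto_sum_kernelPathIntegral hK hst htT hy).const_mul c)).congr fun n => ?_)
  rw [Finset.mul_sum, Finset.mul_sum, ← Finset.sum_add_distrib]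
  exact Finset.sum_congr rfl fun i _ => by ring

theorem integral_kernel_mul_sub_integral_kernel_mul (hK : IntervalIntegrable K volume 0 T)
    (hst : s ≤ t) (htT : t ≤ T) (hx : ContinuousOn x (Set.Iic t)) :
    (∫ r in (0 : ℝ)..t, K (t - r) * x r.toNNReal) - ∫ r in (0 : ℝ)..s, K (s - r) * x r.toNNReal =
      kernelInt K s t 0 * x 0 + kernelPathIntegral K s t x +
        ∫ r in (s : ℝ)..t, K (t - r) * (x r.toNNReal - x s) := by
  have hst' : (s : ℝ) ≤ t := NNReal.coe_le_coe.2 hst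
  have hs : (s : ℝ) ∈ Set.Icc 0 (s : ℝ) := ⟨s.coe_nonneg, le_rfl⟩
  have h0t : (0 : ℝ) ∈ Set.Icc 0 (t : ℝ) := ⟨le_rfl, t.coe_nonneg⟩
  have hst_mem : (s : ℝ) ∈ Set.Icc 0 (t : ℝ) := ⟨s.coe_nonneg, hst'⟩
  have htt : (t : ℝ) ∈ Set.Icc 0 (t : ℝ) := ⟨t.coe_nonneg, le_rfl⟩
  have hint_past := intervalIntegrable_comp_sub_left_mul hK htT hx h0t hst_mem
  have hint_future := intervalIntegrable_comp_sub_left_mul hK htT hx hst_mem htt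
  have hint_s := intervalIntegrable_comp_sub_left_mul hK (hst'.trans htT)
    (hx.mono (Set.Iic_subset_Iic.2 hst)) ⟨le_rfl, s.coe_nonneg⟩ hs
  have hint_const := (intervalIntegrable_comp_sub_left hK htT hst_mem htt).mul_const (x s)
  have hdiff : ∫ r in (0 : ℝ)..s, x r.toNNReal * (K (s - r) - K (t - r)) =
      (∫ r in (0 : ℝ)..s, K (s - r) * x r.toNNReal) -
        ∫ r in (0 : ℝ)..s, K (t - r) * x r.toNNReal := by
    rw [← intervalIntegral.integral_sub hint_s hint_past]
    exact intervalIntegral.integral_congr fun r _ => by ring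
  have hkernel : kernelInt K s t s = ∫ r in (s : ℝ)..t, K (t - r) := by
    rw [kernelInt_eq_integral, intervalIntegral.integral_comp_sub_left, sub_self, sub_self]
  simp_rw [mul_sub (K _)]
  rw [kernelPathIntegral, ← intervalIntegral.integral_add_adjacent_intervals hint_past hint_future,
    intervalIntegral.integral_sub hint_future hint_const, intervalIntegral.integral_mul_const,
    hdiff, hkernel]
  ring

end Kernel

section Moments

variable {Ω : Type*} {mΩ : MeasurableSpace Ω} {P : Measure Ω}

lemma exists_stronglyMeasurable_uncurry_ae_eq {X : ℝ≥0 → Ω → ℝ}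
    (hX : ∀ t, StronglyMeasurable (X t)) (hX_cont : ∀ᵐ ω ∂P, Continuous fun t => X t ω) :
    ∃ Y : ℝ≥0 → Ω → ℝ, StronglyMeasurable (Function.uncurry Y) ∧
      ∀ᵐ ω ∂P, ∀ t, X t ω = Y t ω := by
  obtain ⟨N, hN, hN_meas, hN_null⟩ := exists_measurable_superset_of_null hX_cont
  refine ⟨fun t => Nᶜ.indicator (X t), ?_, ?_⟩
  · refine stronglyMeasurable_uncurry_of_continuous_of_stronglyMeasurable (fun ω => ?_)
      fun t => (hX t).indicator hN_meas.compl
    by_cases hω : ω ∈ N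
    · simpa only [Set.indicator, Set.mem_compl_iff, hω, not_true_eq_false, if_false] using
        continuous_const
    · have hXω : Continuous fun t => X t ω := not_not.1 fun h => hω (hN h)
      simpa only [Set.indicator, Set.mem_compl_iff, hω, not_false_eq_true, if_true] using hXω
  · filter_upwards [measure_eq_zero_iff_ae_notMem.1 hN_null] with ω hω t
    exact (Set.indicator_of_mem hω _).symm

lemma integrable_integral_mul_of_integral_abs_le [SFinite P] {X : ℝ≥0 → Ω → ℝ}
    (hX_meas : ∀ t, StronglyMeasurable (X t)) (hX : ∀ t, Integrable (X t) P)
    (hX_cont : ∀ᵐ ω ∂P, Continuous fun t => X t ω) {k : ℝ → ℝ} {t : ℝ≥0} {C : ℝ}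
    (hC : ∀ r ≤ t, ∫ ω, |X r ω| ∂P ≤ C) (hk : IntervalIntegrable k volume 0 t) :
    Integrable (fun ω => ∫ r in (0 : ℝ)..t, k r * X r.toNNReal ω) P := by
  obtain ⟨Y, hY, hXY⟩ := exists_stronglyMeasurable_uncurry_ae_eq hX_meas hX_cont
  have hXYr : ∀ r, X r =ᵐ[P] Y r := fun r => hXY.mono fun ω h => h r
  let f : Ω × ℝ → ℝ := fun p => k p.2 * Y p.2.toNNReal p.1
  have hk' := (intervalIntegrable_iff_integrableOn_Ioc_of_le t.coe_nonneg).1 hk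
  have hf_meas : AEStronglyMeasurable f (P.prod (volume.restrict (Set.Ioc 0 (t : ℝ)))) :=
    hk'.1.comp_snd.mul (hY.comp_measurable
      ((measurable_real_toNNReal.comp measurable_snd).prodMk measurable_fst)).aestronglyMeasurable
  have hf : Integrable f (P.prod (volume.restrict (Set.Ioc 0 (t : ℝ)))) := by
    rw [integrable_prod_iff' hf_meas]
    refine ⟨ae_of_all _ fun r => ((hX r.toNNReal).congr (hXYr r.toNNReal)).const_mul (k r),
      (hk'.norm.mul_const C).mono' hf_meas.norm.prod_swap.integral_prod_right' ?_⟩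
    filter_upwards [ae_restrict_mem measurableSet_Ioc] with r hr
    have hnorm : ∫ ω, ‖f (ω, r)‖ ∂P = ‖k r‖ * ∫ ω, |X r.toNNReal ω| ∂P := by
      rw [← integral_const_mul]
      refine integral_congr_ae ((hXYr r.toNNReal).mono fun ω hω => ?_)
      simp only [f, norm_mul, hω, Real.norm_eq_abs]
    rw [Real.norm_of_nonneg (integral_nonneg fun _ => norm_nonneg _), hnorm]
    exact mul_le_mul_of_nonneg_left (hC _ (Real.toNNReal_le_iff_le_coe.2 hr.2)) (norm_nonneg _)
  refine hf.integral_prod_left.congr (hXY.mono fun ω hω => ?_)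
  simp only [intervalIntegral.integral_of_le t.coe_nonneg, f, hω]

lemma integrable_integral_mul_of_martingale [SFinite P] {𝓕 : Filtration ℝ≥0 mΩ}
    {M : ℝ≥0 → Ω → ℝ} (hM : Martingale M 𝓕 P) (hM_cont : ∀ᵐ ω ∂P, Continuous fun t => M t ω)
    {k : ℝ → ℝ} {t : ℝ≥0} (hk : IntervalIntegrable k volume 0 t) :
    Integrable (fun ω => ∫ r in (0 : ℝ)..t, k r * M r.toNNReal ω) P := by
  refine integrable_integral_mul_of_integral_abs_le
    (fun r => (hM.stronglyMeasurable r).mono (𝓕.le r)) hM.integrable hM_cont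
    (C := ∫ ω, |M t ω| ∂P) (fun r hr => ?_) hk
  calc ∫ ω, |M r ω| ∂P = ∫ ω, |(P[M t|𝓕 r]) ω| ∂P :=
        integral_congr_ae ((hM.condExp_ae_eq hr).symm.fun_comp abs)
    _ ≤ ∫ ω, |M t ω| ∂P := integral_abs_condExp_le _

end Moments

section Gronwall

variable {K : ℝ → ℝ} {T : ℝ} {s t : ℝ≥0} {u : ℝ≥0 → ℝ}

lemma abs_integral_kernel_mul_le_of_monotoneOn (hK : IntervalIntegrable K volume 0 T)
    (htT : t ≤ T) (hu : MonotoneOn u (Set.Iic t)) (hu0 : 0 ≤ u 0) {a b : ℝ≥0} (hab : a ≤ b)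
    (hbt : b ≤ t) :
    |∫ r in (a : ℝ)..b, K (t - r) * u r.toNNReal| ≤ (∫ r in (t - b : ℝ)..(t - a), |K r|) * u b := by
  have hb : (b : ℝ) ∈ Set.Icc 0 (t : ℝ) := ⟨b.coe_nonneg, NNReal.coe_le_coe.2 hbt⟩
  have ha : (a : ℝ) ∈ Set.Icc 0 (t : ℝ) := ⟨a.coe_nonneg, (NNReal.coe_le_coe.2 hab).trans hb.2⟩
  rw [← intervalIntegral.integral_comp_sub_left (fun r => |K r|) (t : ℝ),
    ← intervalIntegral.integral_mul_const, ← Real.norm_eq_abs]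
  refine intervalIntegral.norm_integral_le_of_norm_le (NNReal.coe_le_coe.2 hab)
    (ae_of_all _ fun r hr => ?_)
    ((intervalIntegrable_comp_sub_left hK htT ha hb).abs.mul_const (u b))
  have hrb : r.toNNReal ≤ b := Real.toNNReal_le_iff_le_coe.2 hr.2
  have hur : 0 ≤ u r.toNNReal :=
    hu0.trans (hu (Set.mem_Iic.2 zero_le) (Set.mem_Iic.2 (hrb.trans hbt)) zero_le)
  rw [norm_mul, Real.norm_eq_abs, Real.norm_of_nonneg hur]
  exact mul_le_mul_of_nonneg_left (hu (Set.mem_Iic.2 (hrb.trans hbt)) hbt hrb) (abs_nonneg _)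

lemma abs_integral_kernel_mul_le_add (hK : IntervalIntegrable K volume 0 T) (hst : s ≤ t)
    (htT : t ≤ T) (hu : MonotoneOn u (Set.Iic t)) (hu_cont : ContinuousOn u (Set.Iic t))
    (hu0 : 0 ≤ u 0) :
    |∫ r in (0 : ℝ)..t, K (t - r) * u r.toNNReal| ≤
      (∫ r in (0 : ℝ)..T, |K r|) * u s + (∫ r in (0 : ℝ)..(t - s), |K r|) * u t := by
  have hst' : (s : ℝ) ∈ Set.Icc 0 (t : ℝ) := ⟨s.coe_nonneg, NNReal.coe_le_coe.2 hst⟩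
  have hus : 0 ≤ u s := hu0.trans (hu (Set.mem_Iic.2 zero_le) hst zero_le)
  have hpast := abs_integral_kernel_mul_le_of_monotoneOn hK htT hu hu0 zero_le hst
  have hfuture := abs_integral_kernel_mul_le_of_monotoneOn hK htT hu hu0 hst le_rfl
  have hmass : ∫ r in (t - s : ℝ)..t, |K r| ≤ ∫ r in (0 : ℝ)..T, |K r| :=
    intervalIntegral.integral_mono_interval (sub_nonneg.2 hst'.2) (sub_le_self _ hst'.1) htT
      (ae_of_all _ fun _ => abs_nonneg _) hK.abs
  rw [NNReal.coe_zero, sub_zero] at hpast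
  rw [sub_self] at hfuture
  rw [← intervalIntegral.integral_add_adjacent_intervals
    (intervalIntegrable_comp_sub_left_mul hK htT hu_cont ⟨le_rfl, t.coe_nonneg⟩ hst')
    (intervalIntegrable_comp_sub_left_mul hK htT hu_cont hst' ⟨t.coe_nonneg, le_rfl⟩)]
  exact (abs_add_le _ _).trans
    (add_le_add (hpast.trans (mul_le_mul_of_nonneg_right hmass hus)) hfuture)

lemma exists_pos_forall_mul_integral_abs_le (hK : IntervalIntegrable K volume 0 T) (hT : 0 ≤ T)
    (b : ℝ) : ∃ δ : ℝ≥0, 0 < δ ∧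
      ∀ x ∈ Set.Icc 0 T, x ≤ δ → |b| * ∫ r in (0 : ℝ)..x, |K r| ≤ 1 / 2 := by
  have hprim := intervalIntegral.continuousOn_primitive_interval
    ((intervalIntegrable_iff' (by simp)).1 hK.abs)
  rw [Set.uIcc_of_le hT] at hprim
  obtain ⟨δ, hδ, hKδ⟩ := Metric.continuousWithinAt_iff.1
    ((hprim.const_mul |b|) 0 ⟨le_rfl, hT⟩) (1 / 2) one_half_pos
  refine ⟨⟨δ / 2, (half_pos hδ).le⟩, half_pos hδ, fun x hx hxδ => ?_⟩
  have := hKδ hx (by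
    rw [Real.dist_0_eq_abs, abs_of_nonneg hx.1]
    exact hxδ.trans_lt (half_lt_self hδ))
  rw [intervalIntegral.integral_same, mul_zero, Real.dist_0_eq_abs] at this
  exact (le_abs_self _).trans this.le

end Gronwall

lemma continuous_min_of_continuousOn {x : ℝ≥0 → ℝ} {T : ℝ≥0} (hx : ContinuousOn x (Set.Iic T)) :
    Continuous fun t => x (min t T) :=
  hx.comp_continuous (continuous_id.min continuous_const) fun _ => Set.mem_Iic.2 (min_le_right _ _)

namespace IsSolution

variable {Ω : Type*} {mΩ : MeasurableSpace Ω} {P : Measure Ω} {𝓕 : Filtration ℝ≥0 mΩ}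
  {K g₀ : ℝ → ℝ} {b c : ℝ} {T t δ : ℝ≥0} {U Z : ℝ≥0 → Ω → ℝ}

lemma integrable_integral_kernel_mul_Z [SFinite P] (h : IsSolution K g₀ b c T 𝓕 P U Z)
    (hK : IntervalIntegrable K volume 0 T) (htT : t ≤ T) :
    Integrable (fun ω => ∫ r in (0 : ℝ)..t, K (t - r) * Z r.toNNReal ω) P := by
  refine (integrable_integral_mul_of_martingale h.Z_martingale
    (h.Z_cont.mono fun ω => continuous_min_of_continuousOn)
    (intervalIntegrable_comp_sub_left hK (NNReal.coe_le_coe.2 htT) ⟨le_rfl, t.coe_nonneg⟩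
      ⟨t.coe_nonneg, le_rfl⟩)).congr
    (ae_of_all _ fun ω => intervalIntegral.integral_congr fun r hr => ?_)
  rw [Set.uIcc_of_le t.coe_nonneg] at hr
  simp only [min_eq_left ((Real.toNNReal_le_iff_le_coe.2 hr.2).trans htT)]

lemma ae_abs_U_le [SFinite P] (h : IsSolution K g₀ b c T 𝓕 P U Z)
    (hK : IntervalIntegrable K volume 0 T) (htT : t ≤ T)
    (hδ : ∀ x ∈ Set.Icc 0 (T : ℝ), x ≤ δ → |b| * ∫ r in (0 : ℝ)..x, |K r| ≤ 1 / 2) :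
    ∀ᵐ ω ∂P, |U t ω| ≤ 2 * (|∫ r in (0 : ℝ)..t, g₀ r| +
      |c| * |∫ r in (0 : ℝ)..t, K (t - r) * Z r.toNNReal ω| +
      |b| * (∫ r in (0 : ℝ)..T, |K r|) * U (t - δ) ω) := by
  have htT' : (t : ℝ) ≤ T := NNReal.coe_le_coe.2 htT
  have hIic := Set.Iic_subset_Iic.2 htT
  have h0t : (0 : ℝ) ∈ Set.Icc 0 (t : ℝ) := ⟨le_rfl, t.coe_nonneg⟩
  have htt : (t : ℝ) ∈ Set.Icc 0 (t : ℝ) := ⟨t.coe_nonneg, le_rfl⟩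
  have hlag : (t : ℝ) - (t - δ : ℝ≥0) ≤ δ := by
    have := NNReal.coe_le_coe.2 (le_tsub_add (a := δ) (b := t))
    rw [NNReal.coe_add] at this
    linarith
  have hlag_mem := sub_mem_Icc_of_le htT'
    ⟨NNReal.coe_nonneg _, NNReal.coe_le_coe.2 (tsub_le_self (a := t) (b := δ))⟩
  filter_upwards [h.equation t htT, h.U_cont, h.Z_cont, h.U_mono, h.U_zero]
    with ω heq hU_cont hZ_cont hU_mono hU0
  have hU_nonneg : 0 ≤ U t ω := hU0 ▸ hU_mono (Set.mem_Iic.2 zero_le) htT zero_le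
  have hU_int := intervalIntegrable_comp_sub_left_mul hK htT' (hU_cont.mono hIic) h0t htt
  have hZ_int := intervalIntegrable_comp_sub_left_mul hK htT' (hZ_cont.mono hIic) h0t htt
  have hlinear : ∫ r in (0 : ℝ)..t, K (t - r) * (b * U r.toNNReal ω + c * Z r.toNNReal ω) =
      b * (∫ r in (0 : ℝ)..t, K (t - r) * U r.toNNReal ω) +
        c * ∫ r in (0 : ℝ)..t, K (t - r) * Z r.toNNReal ω := by
    rw [← intervalIntegral.integral_const_mul, ← intervalIntegral.integral_const_mul,
      ← intervalIntegral.integral_add (hU_int.const_mul b) (hZ_int.const_mul c)]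
    exact intervalIntegral.integral_congr fun r _ => by ring
  have hconv := abs_integral_kernel_mul_le_add hK (tsub_le_self (a := t) (b := δ)) htT'
    (hU_mono.mono hIic) (hU_cont.mono hIic) hU0.ge
  have hb_conv := mul_le_mul_of_nonneg_left hconv (abs_nonneg b)
  have hhalf := mul_le_mul_of_nonneg_right (hδ _ hlag_mem hlag) hU_nonneg
  have hbound : |U t ω| ≤ |∫ r in (0 : ℝ)..t, g₀ r| +
      (|b| * |∫ r in (0 : ℝ)..t, K (t - r) * U r.toNNReal ω| +
        |c| * |∫ r in (0 : ℝ)..t, K (t - r) * Z r.toNNReal ω|) := by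
    rw [heq, hlinear, ← abs_mul, ← abs_mul]
    exact (abs_add_le _ _).trans (add_le_add_right (abs_add_le _ _) _)
  rw [abs_of_nonneg hU_nonneg] at hbound ⊢
  linarith

theorem integrable_U [IsFiniteMeasure P] (h : IsSolution K g₀ b c T 𝓕 P U Z)
    (hK : IntervalIntegrable K volume 0 T) (htT : t ≤ T) : Integrable (U t) P := by
  obtain ⟨δ, hδ, hKδ⟩ := exists_pos_forall_mul_integral_abs_le hK T.coe_nonneg b
  have hstep : ∀ t ≤ T, Integrable (U (t - δ)) P → Integrable (U t) P := fun t htT ht =>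
    ((((integrable_const |∫ r in (0 : ℝ)..t, g₀ r|).fun_add
      ((h.integrable_integral_kernel_mul_Z hK htT).abs.const_mul |c|)).fun_add
      (ht.const_mul _)).const_mul 2).mono'
      ((h.U_adapted t htT).mono (𝓕.le t)).aestronglyMeasurable (h.ae_abs_U_le hK htT hKδ)
  suffices ∀ n : ℕ, ∀ t ≤ T, t ≤ n * δ → Integrable (U t) P by
    obtain ⟨n, hn⟩ := exists_nat_ge (t / δ)
    exact this n t htT ((div_le_iff₀ hδ).1 hn)
  intro n
  induction n with
  | zero =>
    intro t _ ht
    obtain rfl : t = 0 := by simpa using ht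
    exact (integrable_zero _ _ _).congr (h.U_zero.mono fun ω hω => hω.symm)
  | succ n ih =>
    refine fun t htT ht => hstep t htT (ih _ (tsub_le_self.trans htT) (tsub_le_iff_right.2 ?_))
    simpa only [Nat.cast_add_one, add_one_mul] using ht

theorem isQuadVarMajorant [IsFiniteMeasure P] (h : IsSolution K g₀ b c T 𝓕 P U Z)
    (hK : IntervalIntegrable K volume 0 T) :
    IsQuadVarMajorant 𝓕 P (fun t => Z (min t T)) fun t => U (min t T) := by
  have hU_meas : ∀ t, StronglyMeasurable[𝓕 t] (U (min t T)) := fun t =>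
    (h.U_adapted _ (min_le_right t T)).mono (𝓕.mono (min_le_left t T))
  have hU_int : ∀ t, Integrable (U (min t T)) P := fun t => h.integrable_U hK (min_le_right t T)
  have hN : Supermartingale (fun t ω => Z (min t T) ω ^ 2 - U (min t T) ω) 𝓕 P := by
    refine supermartingale_of_locally (h.quadVar.mono fun _ => Martingale.supermartingale)
      (fun t => ((h.Z_martingale.stronglyMeasurable t).pow 2).sub (hU_meas t))
      ((integrable_zero _ _ _).congr ?_) (g := fun t ω => -U (min t T) ω)
      (fun t => (hU_int t).neg) fun t => ?_
    · filter_upwards [h.U_zero, h.Z_zero] with ω hU0 hZ0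
      simp [hU0, hZ0]
    · filter_upwards [h.U_mono] with ω hU_mono r hr
      have := hU_mono (Set.mem_Iic.2 (min_le_right r T)) (Set.mem_Iic.2 (min_le_right t T))
        (min_le_min_right T hr)
      linarith [sq_nonneg (Z (min r T) ω)]
  refine ⟨h.Z_martingale, fun t => (memLp_two_iff_integrable_sq
    ((h.Z_martingale.stronglyMeasurable t).mono (𝓕.le t)).aestronglyMeasurable).2 ?_, hN⟩
  simpa only [sub_add_cancel] using (hN.integrable t).fun_add (hU_int t)

end IsSolution

lemma isItoIntegral_congr {Ω : Type*} {mΩ : MeasurableSpace Ω} {𝓕 : Filtration ℝ≥0 mΩ}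
    {P : Measure Ω} {Z Z' A A' : ℝ≥0 → Ω → ℝ} {H : ℝ → Ω → ℝ} {s : ℝ≥0} {I : Ω → ℝ}
    (hZ : ∀ r ≤ s, Z r = Z' r) (hA : ∀ r ≤ s, A r = A' r) :
    IsItoIntegral 𝓕 P Z A H s I ↔ IsItoIntegral 𝓕 P Z' A' H s I := by
  have hmeasure : ∀ ω, stieltjesMeasure (fun u => A u ω) s = stieltjesMeasure (fun u => A' u ω) s :=
    fun ω => stieltjesMeasure_congr fun r hr => congrFun (hA r hr) ω
  have hintegral : ∀ S : SimplePredictable 𝓕, S.integral Z s = S.integral Z' s := fun S => by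
    ext ω
    simp only [SimplePredictable.integral, hZ _ (min_le_right _ _)]
  simp only [IsItoIntegral, hmeasure, hintegral]

lemma measurable_of_ae_eq_of_null_measurableSet {Ω β : Type*} [MeasurableSpace β]
    {mΩ m : MeasurableSpace Ω} {P : Measure[mΩ] Ω} (hm : ∀ N : Set Ω, P N = 0 → MeasurableSet[m] N)
    {f g : Ω → β} (hg : Measurable[m] g) (hfg : f =ᵐ[P] g) : Measurable[m] f := by
  intro B hB
  have hN : P {ω | f ω ≠ g ω} = 0 := hfg
  have hpreimage : f ⁻¹' B = g ⁻¹' B \ {ω | f ω ≠ g ω} ∪ f ⁻¹' B ∩ {ω | f ω ≠ g ω} := by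
    ext ω
    by_cases hω : f ω = g ω <;> simp [hω]
  rw [hpreimage]
  exact ((hg hB).diff (hm _ hN)).union (hm _ (measure_mono_null Set.inter_subset_right hN))

namespace IsSolution

variable {Ω : Type*} {mΩ : MeasurableSpace Ω} {P : Measure Ω} {𝓕 : Filtration ℝ≥0 mΩ}
  {K g₀ : ℝ → ℝ} {b c : ℝ} {T s t : ℝ≥0} {U Z : ℝ≥0 → Ω → ℝ}

lemma ae_integrable_kernelInt (h : IsSolution K g₀ b c T 𝓕 P U Z)
    (hK : IntervalIntegrable K volume 0 T) (hst : s ≤ t) (htT : t ≤ T) :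
    ∀ᵐ ω ∂P, Integrable (kernelInt K s t) (stieltjesMeasure (fun u => U u ω) s) := by
  have hIic := Set.Iic_subset_Iic.2 (hst.trans htT)
  filter_upwards [h.U_mono, h.U_cont] with ω hU_mono hU_cont
  exact integrable_stieltjesMeasure (hU_mono.mono hIic) (hU_cont.mono hIic)
    (continuousOn_kernelInt hK hst (NNReal.coe_le_coe.2 htT))

lemma tendsto_gridStep_integral (h : IsSolution K g₀ b c T 𝓕 P U Z)
    (hK : IntervalIntegrable K volume 0 T) (hst : s ≤ t) (htT : t ≤ T) :
    ∀ᵐ ω ∂P, Tendsto (fun n => (gridStep 𝓕 (kernelInt K s t) s n).integral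
      (fun t => Z (min t T)) s ω) atTop (𝓝 (kernelPathIntegral K s t fun u => Z u ω)) := by
  have hsT := hst.trans htT
  filter_upwards [h.Z_cont] with ω hZ_cont
  refine (tendsto_sum_kernelPathIntegral hK hst (NNReal.coe_le_coe.2 htT)
    (hZ_cont.mono (Set.Iic_subset_Iic.2 hsT))).congr fun n => ?_
  rw [gridStep_integral]
  refine Finset.sum_congr rfl fun i hi => ?_
  have hi : i + 1 ≤ n + 1 := Finset.mem_range.1 hi
  rw [min_eq_left ((gridPoint_le hi).trans hsT),
    min_eq_left ((gridPoint_le (Nat.le_of_succ_le hi)).trans hsT)]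

theorem isItoIntegral_kernelInt_iff [IsFiniteMeasure P] (h : IsSolution K g₀ b c T 𝓕 P U Z)
    (hK : IntervalIntegrable K volume 0 T) (hst : s ≤ t) (htT : t ≤ T) {I : Ω → ℝ} :
    IsItoIntegral 𝓕 P Z U (fun r _ => kernelInt K s t r) s I ↔
      I =ᵐ[P] fun ω => kernelPathIntegral K s t fun u => Z u ω := by
  have hfreeze {X : ℝ≥0 → Ω → ℝ} : ∀ r ≤ s, X r = X (min r T) := fun r hr => by
    rw [min_eq_left (hr.trans (hst.trans htT))]
  have hV : ∀ᵐ ω ∂P, MonotoneOn (fun t => U (min t T) ω) (Set.Iic s) :=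
    h.U_mono.mono fun ω hω u _ v _ huv => hω (Set.mem_Iic.2 (min_le_right u T))
      (Set.mem_Iic.2 (min_le_right v T)) (min_le_min_right T huv)
  have hV_cont : ∀ᵐ ω ∂P, ContinuousOn (fun t => U (min t T) ω) (Set.Iic s) :=
    h.U_cont.mono fun ω hω => (continuous_min_of_continuousOn hω).continuousOn
  have hM := h.isQuadVarMajorant hK
  have hD := tendstoUniformlyOn_gridStep_eval 𝓕
    (continuousOn_kernelInt hK hst (NNReal.coe_le_coe.2 htT))
  have hlim := h.tendsto_gridStep_integral hK hst htT
  rw [isItoIntegral_congr hfreeze hfreeze]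
  refine ⟨hM.ae_eq_of_isItoIntegral hV hV_cont hD hlim, fun hI =>
    hM.isItoIntegral_of_tendsto hV hV_cont hD ?_⟩
  filter_upwards [hlim, hI] with ω hω hIω
  rwa [hIω]

lemma itoIntegral_kernelInt_ae_eq [IsFiniteMeasure P] (h : IsSolution K g₀ b c T 𝓕 P U Z)
    (hK : IntervalIntegrable K volume 0 T) (hst : s ≤ t) (htT : t ≤ T) :
    itoIntegral 𝓕 P Z U (fun r _ => kernelInt K s t r) s =ᵐ[P]
      fun ω => kernelPathIntegral K s t fun u => Z u ω := by
  have hex : ∃ I, IsItoIntegral 𝓕 P Z U (fun r _ => kernelInt K s t r) s I :=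
    ⟨_, (h.isItoIntegral_kernelInt_iff hK hst htT).2 EventuallyEq.rfl⟩
  rw [itoIntegral, dif_pos hex]
  exact (h.isItoIntegral_kernelInt_iff hK hst htT).1 hex.choose_spec

theorem G_ae_eq [IsFiniteMeasure P] (h : IsSolution K g₀ b c T 𝓕 P U Z)
    (hK : IntervalIntegrable K volume 0 T) (hst : s ≤ t) (htT : t ≤ T) :
    G K g₀ b c 𝓕 P U Z s t =ᵐ[P] fun ω => (∫ u in (s : ℝ)..t, g₀ u) +
      kernelPathIntegral K s t fun u => b * U u ω + c * Z u ω := by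
  have hIic := Set.Iic_subset_Iic.2 (hst.trans htT)
  have htT' : (t : ℝ) ≤ T := NNReal.coe_le_coe.2 htT
  filter_upwards [h.itoIntegral_kernelInt_ae_eq hK hst htT, h.U_mono, h.U_cont, h.Z_cont]
    with ω hito hU_mono hU_cont hZ_cont
  rw [G, hito, integral_kernelInt_stieltjesMeasure hK hst htT' (hU_mono.mono hIic)
      (hU_cont.mono hIic),
    kernelPathIntegral_mul_add_mul hK hst htT' (hU_cont.mono hIic) (hZ_cont.mono hIic)]

theorem exists_stronglyMeasurable_G_ae_eq [IsFiniteMeasure P]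
    (h : IsSolution K g₀ b c T 𝓕 P U Z) (hK : IntervalIntegrable K volume 0 T) (hst : s ≤ t)
    (htT : t ≤ T) : ∃ f, StronglyMeasurable[𝓕 s] f ∧ G K g₀ b c 𝓕 P U Z s t =ᵐ[P] f := by
  have hIic := Set.Iic_subset_Iic.2 (hst.trans htT)
  let X : ℝ≥0 → Ω → ℝ := fun r ω => b * U r ω + c * Z r ω
  have hX : ∀ r ≤ s, StronglyMeasurable[𝓕 s] (X r) := fun r hr => by
    have hrT := hr.trans (hst.trans htT)
    have hZ := h.Z_martingale.stronglyMeasurable r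
    rw [min_eq_left hrT] at hZ
    exact (((h.U_adapted r hrT).const_mul b).add (hZ.const_mul c)).mono (𝓕.mono hr)
  let D : ℕ → Ω → ℝ := fun n ω => (∫ u in (s : ℝ)..t, g₀ u) +
    ∑ i ∈ Finset.range (n + 1), kernelInt K s t (gridPoint s n i) *
      (X (gridPoint s n (i + 1)) ω - X (gridPoint s n i) ω)
  have hD : ∀ n, StronglyMeasurable[𝓕 s] (D n) := fun n =>
    stronglyMeasurable_const.add (Finset.stronglyMeasurable_fun_sum _ fun i hi =>
      ((hX _ (gridPoint_le (Finset.mem_range.1 hi))).sub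
        (hX _ (gridPoint_le (Finset.mem_range.1 hi).le))).const_mul _)
  refine ⟨fun ω => limUnder atTop fun n => D n ω,
    @StronglyMeasurable.limUnder _ _ _ (𝓕 s) _ _ _ _ _ _ _ hD, ?_⟩
  filter_upwards [h.G_ae_eq hK hst htT, h.U_cont, h.Z_cont] with ω hG hU_cont hZ_cont
  rw [hG]
  exact (Tendsto.limUnder_eq (tendsto_const_nhds.add (tendsto_sum_kernelPathIntegral hK hst
    (NNReal.coe_le_coe.2 htT) (((hU_cont.mono hIic).const_mul b).add
      ((hZ_cont.mono hIic).const_mul c))))).symm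

theorem ae_incr_eq [IsFiniteMeasure P] (h : IsSolution K g₀ b c T 𝓕 P U Z)
    (hK : IntervalIntegrable K volume 0 T) (hg : IntervalIntegrable g₀ volume 0 T) (hst : s ≤ t)
    (htT : t ≤ T) :
    ∀ᵐ ω ∂P,
      IntervalIntegrable (fun r : ℝ => K (t - r) *
        (b * incr U s r.toNNReal ω + c * incr Z s r.toNNReal ω)) volume s t ∧
      incr U s t ω = G K g₀ b c 𝓕 P U Z s t ω +
        ∫ r in (s : ℝ)..t, K (t - r) *
          (b * incr U s r.toNNReal ω + c * incr Z s r.toNNReal ω) := by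
  have hst' : (s : ℝ) ∈ Set.Icc 0 (t : ℝ) := ⟨s.coe_nonneg, NNReal.coe_le_coe.2 hst⟩
  have htT' : (t : ℝ) ∈ Set.Icc 0 (T : ℝ) := ⟨t.coe_nonneg, NNReal.coe_le_coe.2 htT⟩
  have hsT : (s : ℝ) ∈ Set.Icc 0 (T : ℝ) := ⟨hst'.1, hst'.2.trans htT'.2⟩
  have hg_split := intervalIntegral.integral_add_adjacent_intervals
    (intervalIntegrable_of_mem_Icc hg ⟨le_rfl, T.coe_nonneg⟩ hsT)
    (intervalIntegrable_of_mem_Icc hg hsT htT')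
  filter_upwards [h.G_ae_eq hK hst htT, h.U_cont, h.Z_cont, h.U_zero, h.Z_zero,
    h.equation t htT, h.equation s (hst.trans htT)]
    with ω hG hU_cont hZ_cont hU0 hZ0 hUt hUs
  let x : ℝ≥0 → ℝ := fun r => b * U r ω + c * Z r ω
  have hx : ContinuousOn x (Set.Iic t) :=
    ((hU_cont.const_mul b).add (hZ_cont.const_mul c)).mono (Set.Iic_subset_Iic.2 htT)
  have hx0 : x 0 = 0 := by simp [x, hU0, hZ0]
  have hincr : ∀ r : ℝ, b * incr U s r.toNNReal ω + c * incr Z s r.toNNReal ω =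
      x r.toNNReal - x s := fun r => by simp only [incr, x]; ring
  have hsplit := integral_kernel_mul_sub_integral_kernel_mul hK hst htT'.2 hx
  rw [hx0, mul_zero, zero_add] at hsplit
  simp only [hincr]
  refine ⟨intervalIntegrable_comp_sub_left_mul hK htT'.2 (hx.sub continuousOn_const) hst'
    ⟨t.coe_nonneg, le_rfl⟩, ?_⟩
  rw [hG, incr]
  linarith

end IsSolution

end Volterra

theorem mainTheorem6_general {Ω : Type*} {mΩ : MeasurableSpace Ω} (P : Measure Ω)
    [IsFiniteMeasure P] (𝓕 : Filtration ℝ≥0 mΩ) (T : ℝ≥0)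
    (K g₀ : ℝ → ℝ) (b c : ℝ) (U Z : ℝ≥0 → Ω → ℝ)
    (hK : IntervalIntegrable K volume 0 T) (hg : IntervalIntegrable g₀ volume 0 T)
    (hUZ : Volterra.IsSolution K g₀ b c T 𝓕 P U Z)
    (s t : ℝ≥0) (hst : s ≤ t) (htT : t ≤ T) :
    (∀ᵐ ω ∂P, Integrable (Volterra.kernelInt K s t)
      (Volterra.stieltjesMeasure (fun u => U u ω) s)) ∧
    (∃ I, Volterra.IsItoIntegral 𝓕 P Z U (fun r _ => Volterra.kernelInt K s t r) s I ∧
      ∀ J, Volterra.IsItoIntegral 𝓕 P Z U (fun r _ => Volterra.kernelInt K s t r) s J →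
        J =ᵐ[P] I) ∧
    AEStronglyMeasurable[𝓕 s] (Volterra.G K g₀ b c 𝓕 P U Z s t) P ∧
    ((∀ N : Set Ω, P N = 0 → MeasurableSet[𝓕 s] N) →
      Measurable[𝓕 s] (Volterra.G K g₀ b c 𝓕 P U Z s t)) ∧
    ∀ᵐ ω ∂P,
      IntervalIntegrable (fun r : ℝ => K (t - r) *
        (b * Volterra.incr U s r.toNNReal ω + c * Volterra.incr Z s r.toNNReal ω)) volume s t ∧
      Volterra.incr U s t ω = Volterra.G K g₀ b c 𝓕 P U Z s t ω +
        ∫ r in (s : ℝ)..t, K (t - r) *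
          (b * Volterra.incr U s r.toNNReal ω + c * Volterra.incr Z s r.toNNReal ω) := by
  obtain ⟨f, hf, hGf⟩ := hUZ.exists_stronglyMeasurable_G_ae_eq hK hst htT
  have hito {I : Ω → ℝ} := hUZ.isItoIntegral_kernelInt_iff hK hst htT (I := I)
  exact ⟨hUZ.ae_integrable_kernelInt hK hst htT,
    ⟨_, hito.2 EventuallyEq.rfl, fun _ => hito.1⟩,
    ⟨f, hf, hGf⟩,
    fun hnull => Volterra.measurable_of_ae_eq_of_null_measurableSet hnull hf.measurable hGf,
    hUZ.ae_incr_eq hK hg hst htT⟩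

theorem mainTheorem6 {Ω : Type*} {mΩ : MeasurableSpace Ω} (P : Measure Ω) [IsProbabilityMeasure P]
    (𝓕 : Filtration ℝ≥0 mΩ) (T : ℝ≥0) (K g₀ : ℝ → ℝ) (b c : ℝ) (U Z : ℝ≥0 → Ω → ℝ)
    (hK : IntervalIntegrable K volume 0 T) (hK_nonneg : ∀ t, 0 < t → t ≤ T → 0 ≤ K t)
    (hg : IntervalIntegrable g₀ volume 0 T) (hg_nonneg : ∀ t, 0 < t → t ≤ T → 0 ≤ g₀ t)
    (hb : b ≤ 0) (hc : 0 ≤ c)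
    (hUZ : Volterra.IsSolution K g₀ b c T 𝓕 P U Z)
    (s t : ℝ≥0) (hst : s ≤ t) (htT : t ≤ T) :
    -- the integrals that define `G_s(t)` exist, the stochastic one uniquely up to null sets
    (∀ᵐ ω ∂P, Integrable (Volterra.kernelInt K s t)
      (Volterra.stieltjesMeasure (fun u => U u ω) s)) ∧
    (∃ I, Volterra.IsItoIntegral 𝓕 P Z U (fun r _ => Volterra.kernelInt K s t r) s I ∧
      ∀ J, Volterra.IsItoIntegral 𝓕 P Z U (fun r _ => Volterra.kernelInt K s t r) s J →
        J =ᵐ[P] I) ∧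
    -- `G_s(t)` is `𝓕_s`-measurable (up to a null set if `𝓕_s` is not complete)
    AEStronglyMeasurable[𝓕 s] (Volterra.G K g₀ b c 𝓕 P U Z s t) P ∧
    ((∀ N : Set Ω, P N = 0 → MeasurableSet[𝓕 s] N) →
      Measurable[𝓕 s] (Volterra.G K g₀ b c 𝓕 P U Z s t)) ∧
    -- the dynamics of the increments
    ∀ᵐ ω ∂P,
      IntervalIntegrable (fun r : ℝ => K (t - r) *
        (b * Volterra.incr U s r.toNNReal ω + c * Volterra.incr Z s r.toNNReal ω)) volume s t ∧
      Volterra.incr U s t ω = Volterra.G K g₀ b c 𝓕 P U Z s t ω +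
        ∫ r in (s : ℝ)..t, K (t - r) *
          (b * Volterra.incr U s r.toNNReal ω + c * Volterra.incr Z s r.toNNReal ω) :=
  mainTheorem6_general P 𝓕 T K g₀ b c U Z hK hg hUZ s t hst htT
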